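/- Let $N\ge 1$ and $\Omega=\{x=(x',x_N)\in\mathbb R^N : x_N>0\}$ with $x'\in\mathbb R^{N-1}$. Let $\sigma$ be the surface measure on $\partial\Omega$, that is, $(N-1)$-dimensional Lebesgue measure under the identification $\partial\Omega=\mathbb R^{N-1}$ (for $N=1$, $\partial\Omega=\{0\}$ and $\sigma(\{0\})=1$). Let $\Gamma_N(x,t)=(4\pi t)^{-N/2}e^{-|x|^2/(4t)}$ for $(x,t)\in\mathbb R^N\times(0,\infty)$, let $e_N=(0,\dots,0,1)$, and let $y^*=(y',-y_N)$ for $y=(y',y_N)\in\overline\Omega$. For $x,y\in\overline\Omega$ and $t>0$ let $$G(x,y,t)=\Gamma_N(x-y,t)-\Gamma_N(x-y^*,t)-2\int_0^t(\partial_{x_N}\Gamma_N)(x-y^*+\tau e_N,t-\tau)\,d\tau ,$$ which is the (nonnegative) fundamental solution of the heat equation $\partial_t u=\Delta u$ in $\Omega\times(0,\infty)$ with the dynamical boundary condition $\partial_t u-\partial_{x_N}u=0$ on $\partial\Omega\times(0,\infty)$. For a pair $\phi=(\phi^i,\phi^b)$ of measurable functions on $\Omega$ and on $\partial\Omega$,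 respectively, let $$[\mathsf G(t)\phi](x)=\int_\Omega G(x,y,t)\phi^i(y)\,dy+\int_{\partial\Omega}G(x,y,t)\phi^b(y)\,d\sigma(y),\qquad x\in\overline\Omega,\ t>0,$$ whenever this is well defined. A function $f$ on $\overline\Omega$ is identified with the pair $(f|_\Omega,f|_{\partial\Omega})$. (1) For all $x,y\in\overline\Omega$, $t\in[0,\infty)$ and $s\in(0,\infty)$, $$G(x,y,t+s)=\int_\Omega G(x,z,t)G(z,y,s)\,dz+\int_{\partial\Omega}G(x,z,t)G(z,y,s)\,d\sigma(z).$$ For $t>0$ both integrals converge absolutely; for $t=0$ the right-hand side means its limit as $t\to+0$. (2) Let $\phi^i$ and $\phi^b$ be nonnegative measurable functions on $\Omega$ and on $\partial\Omega$, respectively (in which case $\mathsf G(t)\phi$ takes values in $[0,\infty]$), or let $(\phi^i,\phi^b)\in L^q(\Omega)\times L^q(\partial\Omega)$ for some $q\in[1,\infty]$. Then, for all $t,s\in(0,\infty)$, $$\mathsf G(t)\mathsf G(s)\phi=\mathsf G(t+s)\phi\quad\text{at every point of }\overline\Omega .$$ In the second case all the integrals that define $\mathsf G(s)\phi$, $\mathsf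 G(t)\mathsf G(s)\phi$ and $\mathsf G(t+s)\phi$ converge absolutely at every point of $\overline\Omega$. -/

import Mathlib

open MeasureTheory Filter Topology

open scoped ENNReal

/-! The heat equation on the half-space of `ℝ^N` with the homogeneous dynamical boundary
condition. Throughout, the dimension is `N = n + 1` with `n : ℕ`, so that `N ≥ 1` is arbitrary;
a point `x = (x', x_N)` of `ℝ^N` has the last coordinate `x_N = x (Fin.last n)`. -/

namespace DynBdry

noncomputable section

/-- The unit vector `e_N = (0, …, 0, 1)`. -/
def eN (n : ℕ) : EuclideanSpace ℝ (Fin (n + 1)) := EuclideanSpace.single (Fin.last n) 1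

/-- The open half-space `Ω = {x : x_N > 0}`. -/
def halfSpace (n : ℕ) : Set (EuclideanSpace ℝ (Fin (n + 1))) := {x | 0 < x (Fin.last n)}

/-- The identification of `ℝ^(N-1)` with `∂Ω`, `x' ↦ (x', 0)`. -/
def bdryPoint {n : ℕ} (x' : EuclideanSpace ℝ (Fin n)) : EuclideanSpace ℝ (Fin (n + 1)) :=
  WithLp.toLp 2 (Fin.snoc (α := fun _ => ℝ) x'.ofLp 0)

theorem continuous_bdryPoint {n : ℕ} : Continuous (bdryPoint (n := n)) := by
  refine (PiLp.continuous_toLp 2 _).comp (continuous_pi fun i => ?_)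
  refine Fin.lastCases ?_ (fun j => ?_) i
  · simpa using continuous_const
  · simp only [Fin.snoc_castSucc]
    fun_prop

theorem measurable_bdryPoint {n : ℕ} : Measurable (bdryPoint (n := n)) :=
  continuous_bdryPoint.measurable

/-- The Lebesgue measure `dx` on `Ω`, as a measure on `ℝ^N`. -/
def intMeasure (n : ℕ) : Measure (EuclideanSpace ℝ (Fin (n + 1))) := volume.restrict (halfSpace n)

/-- The surface measure `σ` on `∂Ω`, as a measure on `ℝ^N`: the image of the Lebesgue measure of
`ℝ^(N-1)` under `x' ↦ (x', 0)`. For `N = 1` this is the unit mass at the only boundary point. -/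
def bdryMeasure (n : ℕ) : Measure (EuclideanSpace ℝ (Fin (n + 1))) :=
  Measure.map bdryPoint (volume : Measure (EuclideanSpace ℝ (Fin n)))

/-- The Gauss kernel `Γ_d(x,t) = (4πt)^(-d/2) exp(-|x|²/(4t))` on `ℝ^d × (0,∞)`. -/
def gaussKernel {d : ℕ} (x : EuclideanSpace ℝ (Fin d)) (t : ℝ) : ℝ :=
  (4 * Real.pi * t) ^ (-(d : ℝ) / 2) * Real.exp (-‖x‖ ^ 2 / (4 * t))

/-- The reflection `y* = (y', -y_N)`. -/
def reflect {n : ℕ} (y : EuclideanSpace ℝ (Fin (n + 1))) : EuclideanSpace ℝ (Fin (n + 1)) :=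
  y - (2 * y (Fin.last n)) • eN n

/-- `∂_{x_N} Γ_N (x,t)`. -/
def dGaussKernel {n : ℕ} (x : EuclideanSpace ℝ (Fin (n + 1))) (t : ℝ) : ℝ :=
  lineDeriv ℝ (fun z => gaussKernel z t) x (eN n)

/-- `H(x,y,t) = -2 ∫_0^t (∂_{x_N} Γ_N)(x - y* + τ e_N, t - τ) dτ`. -/
def kernelH {n : ℕ} (x y : EuclideanSpace ℝ (Fin (n + 1))) (t : ℝ) : ℝ :=
  -2 * ∫ τ in (0 : ℝ)..t, dGaussKernel (x - reflect y + τ • eN n) (t - τ)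

/-- The fundamental solution
`G(x,y,t) = Γ_N(x-y,t) - Γ_N(x-y*,t) + H(x,y,t)`, for `x, y ∈ closure Ω` and `t > 0`. -/
def kernelG {n : ℕ} (x y : EuclideanSpace ℝ (Fin (n + 1))) (t : ℝ) : ℝ :=
  gaussKernel (x - y) t - gaussKernel (x - reflect y) t + kernelH x y t

/-- `[G(t)φ](x) = ∫_Ω G(x,y,t) φ^i(y) dy + ∫_{∂Ω} G(x,y,t) φ^b(y) dσ(y)` for real-valued data
`φ = (φ^i, φ^b)`; only the values of `φ^i` on `Ω` and of `φ^b` on `∂Ω` matter. -/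
def evol {n : ℕ} (t : ℝ) (φi φb : EuclideanSpace ℝ (Fin (n + 1)) → ℝ)
    (x : EuclideanSpace ℝ (Fin (n + 1))) : ℝ :=
  (∫ y, kernelG x y t * φi y ∂(intMeasure n)) + ∫ y, kernelG x y t * φb y ∂(bdryMeasure n)

/-- Both integrals in the definition of `[G(t)φ](x)` converge absolutely. -/
def EvolDefined {n : ℕ} (t : ℝ) (φi φb : EuclideanSpace ℝ (Fin (n + 1)) → ℝ)
    (x : EuclideanSpace ℝ (Fin (n + 1))) : Prop :=
  Integrable (fun y => kernelG x y t * φi y) (intMeasure n) ∧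
    Integrable (fun y => kernelG x y t * φb y) (bdryMeasure n)

/-- `[G(t)φ](x)` for data with values in `[0,∞]`, as an element of `[0,∞]`.
The kernel is nonnegative, see `kernelG_nonneg`. -/
def evolNonneg {n : ℕ} (t : ℝ) (φi φb : EuclideanSpace ℝ (Fin (n + 1)) → ℝ≥0∞)
    (x : EuclideanSpace ℝ (Fin (n + 1))) : ℝ≥0∞ :=
  (∫⁻ y, ENNReal.ofReal (kernelG x y t) * φi y ∂(intMeasure n)) +
    ∫⁻ y, ENNReal.ofReal (kernelG x y t) * φb y ∂(bdryMeasure n)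

theorem dGaussKernel_eq {n : ℕ} (x : EuclideanSpace ℝ (Fin (n + 1))) (t : ℝ) :
    dGaussKernel x t = -(x (Fin.last n) / (2 * t)) * gaussKernel x t := by
  have hnorm : ∀ h : ℝ, ‖x + h • eN n‖ ^ 2 = ‖x‖ ^ 2 + 2 * h * x (Fin.last n) + h ^ 2 := by
    intro h
    rw [norm_add_sq_real, inner_smul_right, norm_smul, mul_pow]
    simp [eN, EuclideanSpace.inner_single_right]
    ring
  have key : HasDerivAt (fun h : ℝ => gaussKernel (x + h • eN n) t)
      (-(x (Fin.last n) / (2 * t)) * gaussKernel x t) 0 := by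
    simp only [gaussKernel, hnorm]
    have h1 : HasDerivAt (fun h : ℝ => -(‖x‖ ^ 2 + 2 * h * x (Fin.last n) + h ^ 2) / (4 * t))
        (-(2 * x (Fin.last n)) / (4 * t)) 0 := by
      have := (((((hasDerivAt_id (0 : ℝ)).const_mul 2).mul_const (x (Fin.last n))).const_add
        (‖x‖ ^ 2)).add ((hasDerivAt_id (0 : ℝ)).pow 2)).neg.div_const (4 * t)
      refine this.congr_deriv ?_
      simp
    refine (h1.exp.const_mul _).congr_deriv ?_
    simp only [mul_zero, zero_mul, add_zero, ne_eq, OfNat.ofNat_ne_zero, not_false_eq_true,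
      zero_pow]
    have : -(2 * x (Fin.last n)) / (4 * t) = -(x (Fin.last n) / (2 * t)) := by
      rcases eq_or_ne t 0 with rfl | ht
      · simp
      · field_simp
        ring
    rw [this]
    ring
  exact key.deriv

theorem closure_halfSpace_subset (n : ℕ) :
    closure (halfSpace n) ⊆ {x | 0 ≤ x (Fin.last n)} :=
  closure_minimal (fun x (hx : 0 < x (Fin.last n)) => le_of_lt hx) (isClosed_le (by fun_prop) (by fun_prop))

theorem kernelG_nonneg {n : ℕ} {x y : EuclideanSpace ℝ (Fin (n + 1))} {t : ℝ}
    (hx : x ∈ closure (halfSpace n)) (hy : y ∈ closure (halfSpace n)) (ht : 0 < t) :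
    0 ≤ kernelG x y t := by
  have hx0 : 0 ≤ x (Fin.last n) := closure_halfSpace_subset n hx
  have hy0 : 0 ≤ y (Fin.last n) := closure_halfSpace_subset n hy
  have hz : ∀ τ : ℝ, (x - reflect y + τ • eN n) (Fin.last n) =
      x (Fin.last n) + y (Fin.last n) + τ := by
    intro τ
    simp [reflect, eN]
    ring
  have hH : 0 ≤ kernelH x y t := by
    have : ∫ τ in (0 : ℝ)..t, dGaussKernel (x - reflect y + τ • eN n) (t - τ) ≤ 0 := by
      rw [← neg_nonneg, ← intervalIntegral.integral_neg]
      refine intervalIntegral.integral_nonneg ht.le fun τ hτ => ?_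
      rw [dGaussKernel_eq, hz, neg_mul]
      have h1 : 0 ≤ t - τ := by linarith [hτ.2]
      have h2 : 0 ≤ τ := hτ.1
      have h3 := Real.pi_pos
      unfold gaussKernel
      have : 0 ≤ (4 * Real.pi * (t - τ)) ^ (-((n + 1 : ℕ) : ℝ) / 2) :=
        Real.rpow_nonneg (by positivity) _
      rw [neg_neg]
      positivity
    unfold kernelH
    linarith
  have hn : ‖x - y‖ ^ 2 ≤ ‖x - reflect y‖ ^ 2 := by
    have : x - reflect y = (x - y) + (2 * y (Fin.last n)) • eN n := by
      simp only [reflect]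
      abel
    rw [this, norm_add_sq_real, inner_smul_right, norm_smul, mul_pow]
    simp [eN, EuclideanSpace.inner_single_right, mul_pow, sq_abs]
    nlinarith [mul_nonneg hx0 hy0]
  have hG : gaussKernel (x - reflect y) t ≤ gaussKernel (x - y) t := by
    have h3 := Real.pi_pos
    unfold gaussKernel
    gcongr
  unfold kernelG
  linarith

end

end DynBdry

/-!
The kernel `G` is the transition density, with respect to `dx + σ`, of the diffusion with
generator `Δ` in `Ω` that is delayed at `∂Ω`: it stands still there for a time equal to the
increase of its local time, and its tangential component moves only while it is in the interior. Accordingly,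
`G` is a mixture of tangential Gauss kernels `Γ_{N-1}(x' - y', t - τ)`, where `τ` is the time spent
at the boundary. The mixing measure `sojourn a c t` depends on the normal coordinates only: it has
the Dirichlet heat kernel of the half-line as an atom at `τ = 0`, and the density
`hitDensity (a + c + τ) (t - τ)`, where `hitDensity a u = (a / u) Γ_1(a, u)`, on `(0, t)`.

Everything is nonnegative, so the order of integration is free. Integrating the tangential
variable with the Gauss semigroup reduces the identity
`G(x, y, t + s) = ∫ G(x, z, t) G(z, y, s) (dz + dσ)` to the assertion `sojourn_semigroup` that the
boundary times before and after the intermediate time add up. On the level of densities, for a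
total boundary time `ρ`, this is `hitDensity_decomposition`. The mechanism is as follows. For
`a = x_N + τ`, `u = t - τ`, `b = y_N + ρ - τ`, `v = s - ρ + τ` let
`entrance a u b v = ∫_0^∞ dirichlet a z u * hitDensity (b + z) v dz`. Since `∂_u = ∂_a²` and
`∂_v = ∂_b²` on these kernels, `d/dτ` acts as `(∂_a - ∂_b)(1 - ∂_a - ∂_b)`; the derivative of
`entrance` along the segment is
`∫_0^∞ hitDensity (a + z) u * hitDensity (b + z) v dz + hitDensity a u * hitDensity b v`,
which is the contribution of paths with boundary time on both sides (`hasDerivAt_entrance`).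
Together with `entrance a u b v + entrance b v a u = hitDensity (a + b) (u + v)` this gives the
decomposition by the fundamental theorem of calculus. All half-line integrals involved are
elementary in terms of `Γ_1` and the Gauss tail `gaussTail`.

The limit `t → 0+` then only needs the continuity of `G` in time (`continuousAt_kernelG`), and the
semigroup property for nonnegative data is Tonelli's theorem. For data in `L^q`, the kernel
`G(x, ·, t)` is bounded (`exists_kernelG_le`) and has total mass one (`lintegral_kernelG`), so all
integrals converge absolutely and Fubini's theorem applies.
-/

namespace DynBdry

noncomputable section

/-! ### Gaussian integrals in one variable -/

/-- The Gauss kernel `Γ_1(a, u)` of the line. -/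
def gauss (a u : ℝ) : ℝ := Real.exp (-a ^ 2 / (4 * u)) / √(4 * Real.pi * u)

/-- `(a / u) Γ_1(a, u) = -2 ∂_a Γ_1(a, u)`: the density at time `u` of the first visit to `0` of the
diffusion with generator `∂²` started at `a`. -/
def hitDensity (a u : ℝ) : ℝ := a / u * gauss a u

/-- The Gauss tail `π^(-1/2) ∫_q^∞ exp(-z²) dz`, half the complementary error function, written as
a proper integral by means of its value `1 / 2` at `q = 0`. -/
def gaussTail (q : ℝ) : ℝ := 1 / 2 - (∫ z in (0 : ℝ)..q, Real.exp (-z ^ 2)) / √Real.pi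

/-- The argument of `gaussTail` for which `Γ_1(a - b, u + v) * gaussTail (bridge a u b v)` is
`∫_0^∞ Γ_1(a + z, u) Γ_1(b + z, v) dz`. -/
def bridge (a u b v : ℝ) : ℝ := (a * v + b * u) / (2 * √(u * v * (u + v)))

theorem gauss_nonneg (a u : ℝ) : 0 ≤ gauss a u := by unfold gauss; positivity

theorem hitDensity_nonneg {a u : ℝ} (ha : 0 ≤ a) (hu : 0 ≤ u) : 0 ≤ hitDensity a u :=
  mul_nonneg (div_nonneg ha hu) (gauss_nonneg a u)

theorem gauss_neg (a u : ℝ) : gauss (-a) u = gauss a u := by simp [gauss]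

theorem hitDensity_neg (a u : ℝ) : hitDensity (-a) u = -hitDensity a u := by
  simp only [hitDensity, gauss_neg]; ring

theorem gauss_le_gauss {a b u : ℝ} (hu : 0 ≤ u) (h : a ^ 2 ≤ b ^ 2) : gauss b u ≤ gauss a u := by
  unfold gauss
  gcongr

theorem hasDerivAt_gauss (a : ℝ) {u : ℝ} (hu : 0 < u) :
    HasDerivAt (fun z => gauss z u) (-hitDensity a u / 2) a := by
  unfold hitDensity gauss
  have h := ((((hasDerivAt_id a).pow 2).neg.div_const (4 * u)).exp.div_const (√(4 * Real.pi * u)))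
  refine h.congr_deriv ?_
  simp
  field_simp
  ring

theorem hasDerivAt_hitDensity (a : ℝ) {u : ℝ} (hu : 0 < u) :
    HasDerivAt (fun z => hitDensity z u) ((1 / u - a ^ 2 / (2 * u ^ 2)) * gauss a u) a := by
  have h := ((hasDerivAt_id a).div_const u).mul (hasDerivAt_gauss a hu)
  refine h.congr_deriv ?_
  simp [hitDensity]
  field_simp
  ring

theorem hasDerivAt_gaussTail (q : ℝ) :
    HasDerivAt gaussTail (-(Real.exp (-q ^ 2) / √Real.pi)) q := by
  have hc : Continuous fun z : ℝ => Real.exp (-z ^ 2) := by fun_prop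
  have h := intervalIntegral.integral_hasDerivAt_right (hc.intervalIntegrable 0 q)
    (hc.stronglyMeasurableAtFilter _ _) hc.continuousAt
  exact (h.div_const (√Real.pi)).const_sub (1 / 2)

theorem continuous_gaussTail : Continuous gaussTail :=
  continuous_iff_continuousAt.2 fun q => (hasDerivAt_gaussTail q).continuousAt

theorem gaussTail_neg (q : ℝ) : gaussTail (-q) = 1 - gaussTail q := by
  have h : ∫ z in (0 : ℝ)..(-q), Real.exp (-z ^ 2) = -∫ z in (0 : ℝ)..q, Real.exp (-z ^ 2) := by
    have := intervalIntegral.integral_comp_neg (a := 0) (b := q) fun z : ℝ => Real.exp (-z ^ 2)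
    simp only [neg_sq, neg_zero] at this
    rw [this, intervalIntegral.integral_symm]
  simp only [gaussTail, h]
  ring

theorem tendsto_gaussTail_atTop : Tendsto gaussTail atTop (𝓝 0) := by
  have hi : IntegrableOn (fun z : ℝ => Real.exp (-z ^ 2)) (Set.Ioi 0) := by
    simpa using (integrable_exp_neg_mul_sq (b := 1) one_pos).integrableOn
  have h := intervalIntegral_tendsto_integral_Ioi 0 hi tendsto_id
  have hv : ∫ z in Set.Ioi (0 : ℝ), Real.exp (-z ^ 2) = √Real.pi / 2 := by
    simpa using integral_gaussian_Ioi 1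
  rw [hv] at h
  have h2 := (h.div_const (√Real.pi)).const_sub (1 / 2)
  have : (1 / 2 : ℝ) - √Real.pi / 2 / √Real.pi = 0 := by
    have : √Real.pi ≠ 0 := by positivity
    field_simp
    ring
  rw [this] at h2
  exact h2

/-- Completing the square. The last two factors are the density of the Brownian bridge at `0`, that
is, minus the derivative of `gaussTail (bridge (a + z) u (b + z) v)` at `z = 0`. -/
theorem gauss_mul_gauss (a b : ℝ) {u v : ℝ} (hu : 0 < u) (hv : 0 < v) :
    gauss a u * gauss b v = gauss (a - b) (u + v) *
      (Real.exp (-bridge a u b v ^ 2) / √Real.pi) * ((u + v) / (2 * √(u * v * (u + v)))) := by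
  have hw : 0 < u + v := by positivity
  have hpi := Real.pi_pos
  have h4 : √(4 : ℝ) = 2 := by
    rw [show (4 : ℝ) = 2 ^ 2 by norm_num]; exact Real.sqrt_sq (by norm_num)
  have hexp : Real.exp (-a ^ 2 / (4 * u)) * Real.exp (-b ^ 2 / (4 * v)) =
      Real.exp (-(a - b) ^ 2 / (4 * (u + v))) * Real.exp (-bridge a u b v ^ 2) := by
    rw [← Real.exp_add, ← Real.exp_add]
    congr 1
    have : bridge a u b v ^ 2 = (a * v + b * u) ^ 2 / (4 * (u * v * (u + v))) := by
      rw [bridge, div_pow, mul_pow, Real.sq_sqrt (by positivity)]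
      norm_num
    rw [this]
    field_simp
    ring
  have hs : ∀ r : ℝ, √(4 * Real.pi * r) = 2 * √Real.pi * √r := fun r => by
    rw [Real.sqrt_mul (by positivity), Real.sqrt_mul (by norm_num), h4]
  have hs3 : √(u * v * (u + v)) = √u * √v * √(u + v) := by
    rw [Real.sqrt_mul (by positivity), Real.sqrt_mul (by positivity)]
  have hww : √(u + v) ^ 2 = u + v := Real.sq_sqrt hw.le
  have e : gauss a u * gauss b v =
    (Real.exp (-a ^ 2 / (4 * u)) * Real.exp (-b ^ 2 / (4 * v))) /
      (√(4 * Real.pi * u) * √(4 * Real.pi * v)) := by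
    unfold gauss; ring
  rw [e, hexp, gauss, hs, hs, hs, hs3]
  have h1 : √u ≠ 0 := by positivity
  have h2 : √v ≠ 0 := by positivity
  have h3 : √(u + v) ≠ 0 := by positivity
  have h5 : √Real.pi ≠ 0 := by positivity
  generalize Real.exp (-bridge a u b v ^ 2) = X
  generalize Real.exp (-(a - b) ^ 2 / (4 * (u + v))) = Y
  generalize √(u + v) = W at *
  rw [← hww]
  field_simp

theorem hasDerivAt_gaussTail_bridge (a b z : ℝ) (u v : ℝ) :
    HasDerivAt (fun z => gaussTail (bridge (a + z) u (b + z) v))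
      (-(Real.exp (-bridge (a + z) u (b + z) v ^ 2) / √Real.pi) *
        ((u + v) / (2 * √(u * v * (u + v))))) z := by
  have h : HasDerivAt (fun z => bridge (a + z) u (b + z) v)
      ((u + v) / (2 * √(u * v * (u + v)))) z := by
    unfold bridge
    refine (((((hasDerivAt_id z).const_add a).mul_const v).add
      (((hasDerivAt_id z).const_add b).mul_const u)).div_const _).congr_deriv ?_
    ring
  exact (hasDerivAt_gaussTail _).comp z h

theorem tendsto_bridge_atTop (a b : ℝ) {u v : ℝ} (hu : 0 < u) (hv : 0 < v) :
    Tendsto (fun z => bridge (a + z) u (b + z) v) atTop atTop := by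
  have : (fun z => bridge (a + z) u (b + z) v) = fun z =>
      (a * v + b * u) / (2 * √(u * v * (u + v))) + (u + v) / (2 * √(u * v * (u + v))) * z := by
    ext z; unfold bridge; ring
  rw [this]
  exact tendsto_atTop_add_const_left _ _ (tendsto_id.const_mul_atTop (by positivity))

/-- Antiderivatives are taken in a common shift `z` of both arguments, under which `a - b` is
constant. -/
theorem hasDerivAt_gauss_mul_gauss (a b z : ℝ) {u v : ℝ} (hu : 0 < u) (hv : 0 < v) :
    HasDerivAt (fun z => -(gauss (a - b) (u + v) * gaussTail (bridge (a + z) u (b + z) v)))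
      (gauss (a + z) u * gauss (b + z) v) z := by
  refine ((hasDerivAt_gaussTail_bridge a b z u v).const_mul _).neg.congr_deriv ?_
  rw [gauss_mul_gauss _ _ hu hv]
  simp only [add_sub_add_right_eq_sub]
  ring

/-- Obtained from `hasDerivAt_gauss_mul_gauss` by applying `-2 ∂_b`. -/
theorem hasDerivAt_gauss_mul_hitDensity (a b z : ℝ) {u v : ℝ} (hu : 0 < u) (hv : 0 < v) :
    HasDerivAt (fun z => hitDensity (a - b) (u + v) * gaussTail (bridge (a + z) u (b + z) v) -
        2 * (u / (u + v)) * (gauss (a + z) u * gauss (b + z) v))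
      (gauss (a + z) u * hitDensity (b + z) v) z := by
  have hw : 0 < u + v := by positivity
  -- The tail term is a multiple of the antiderivative of `gauss * gauss`.
  have e : (fun z => hitDensity (a - b) (u + v) * gaussTail (bridge (a + z) u (b + z) v) -
        2 * (u / (u + v)) * (gauss (a + z) u * gauss (b + z) v)) = fun z =>
      (-((a - b) / (u + v))) *
          -(gauss (a - b) (u + v) * gaussTail (bridge (a + z) u (b + z) v)) -
        2 * (u / (u + v)) * (gauss (a + z) u * gauss (b + z) v) := by
    ext z; unfold hitDensity; ring
  rw [e]
  have h1 := (hasDerivAt_gauss (a + z) hu).comp_const_add a z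
  have h2 := (hasDerivAt_gauss (b + z) hv).comp_const_add b z
  refine (((hasDerivAt_gauss_mul_gauss a b z hu hv).const_mul _).sub
    ((h1.mul h2).const_mul _)).congr_deriv ?_
  unfold hitDensity
  field_simp
  ring

/-- Obtained from `hasDerivAt_gauss_mul_gauss` by applying `4 ∂_a ∂_b`. -/
theorem hasDerivAt_hitDensity_mul_hitDensity (a b z : ℝ) {u v : ℝ} (hu : 0 < u) (hv : 0 < v) :
    HasDerivAt (fun z => -(2 * ((1 / (u + v) - (a - b) ^ 2 / (2 * (u + v) ^ 2)) *
          gauss (a - b) (u + v)) * gaussTail (bridge (a + z) u (b + z) v)) -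
        2 * (((a + z) * u + (b + z) * v) / (u + v) ^ 2) * (gauss (a + z) u * gauss (b + z) v))
      (hitDensity (a + z) u * hitDensity (b + z) v) z := by
  have hw : 0 < u + v := by positivity
  have e : (fun z => -(2 * ((1 / (u + v) - (a - b) ^ 2 / (2 * (u + v) ^ 2)) *
          gauss (a - b) (u + v)) * gaussTail (bridge (a + z) u (b + z) v)) -
        2 * (((a + z) * u + (b + z) * v) / (u + v) ^ 2) * (gauss (a + z) u * gauss (b + z) v)) =
      fun z => (2 * (1 / (u + v) - (a - b) ^ 2 / (2 * (u + v) ^ 2))) *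
          -(gauss (a - b) (u + v) * gaussTail (bridge (a + z) u (b + z) v)) -
        2 * (((a + z) * u + (b + z) * v) / (u + v) ^ 2 *
          (gauss (a + z) u * gauss (b + z) v)) := by
    ext z; ring
  rw [e]
  have h1 := (hasDerivAt_gauss (a + z) hu).comp_const_add a z
  have h2 := (hasDerivAt_gauss (b + z) hv).comp_const_add b z
  have h3 : HasDerivAt (fun z => ((a + z) * u + (b + z) * v) / (u + v) ^ 2)
      ((u + v) / (u + v) ^ 2) z := by
    refine (((((hasDerivAt_id z).const_add a).mul_const u).add
      (((hasDerivAt_id z).const_add b).mul_const v)).div_const _).congr_deriv ?_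
    ring
  refine (((hasDerivAt_gauss_mul_gauss a b z hu hv).const_mul _).sub
    ((h3.mul (h1.mul h2)).const_mul _)).congr_deriv ?_
  unfold hitDensity
  simp only [Pi.mul_apply]
  field_simp
  ring

/-! ### Half-line integrals of the one-dimensional kernels -/

theorem tendsto_gauss_atTop {u : ℝ} (hu : 0 < u) :
    Tendsto (fun z => gauss z u) atTop (𝓝 0) := by
  have h1 : Tendsto (fun z : ℝ => -z ^ 2 / (4 * u)) atTop atBot := by
    have : Tendsto (fun z : ℝ => z ^ 2 / (4 * u)) atTop atTop :=
      (tendsto_pow_atTop two_ne_zero).atTop_div_const (by positivity)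
    refine (tendsto_neg_atTop_atBot.comp this).congr fun z => ?_
    simp [neg_div]
  simpa [gauss] using (Real.tendsto_exp_atBot.comp h1).div_const (√(4 * Real.pi * u))

theorem tendsto_hitDensity_atTop {u : ℝ} (hu : 0 < u) :
    Tendsto (fun z => hitDensity z u) atTop (𝓝 0) := by
  have h1 : Tendsto (fun z : ℝ => 4 / √(4 * Real.pi * u) / z) atTop (𝓝 0) :=
    tendsto_const_nhds.div_atTop tendsto_id
  refine squeeze_zero' ?_ ?_ h1
  · filter_upwards [eventually_ge_atTop 0] with z hz using hitDensity_nonneg hz hu.le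
  · filter_upwards [eventually_gt_atTop 0] with z hz
    have hp : 0 < z ^ 2 / (4 * u) := by positivity
    have hexp : Real.exp (-z ^ 2 / (4 * u)) ≤ 1 / (z ^ 2 / (4 * u)) := by
      rw [neg_div, Real.exp_neg, ← one_div]
      exact one_div_le_one_div_of_le hp (by linarith [Real.add_one_le_exp (z ^ 2 / (4 * u))])
    unfold hitDensity gauss
    calc z / u * (Real.exp (-z ^ 2 / (4 * u)) / √(4 * Real.pi * u))
        ≤ z / u * (1 / (z ^ 2 / (4 * u)) / √(4 * Real.pi * u)) := by gcongr
      _ = 4 / √(4 * Real.pi * u) / z := by field_simp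

theorem tendsto_gauss_mul_gauss (a b : ℝ) {u v : ℝ} (hu : 0 < u) (hv : 0 < v) :
    Tendsto (fun z => gauss (a + z) u * gauss (b + z) v) atTop (𝓝 0) := by
  simpa using ((tendsto_gauss_atTop hu).comp (tendsto_atTop_add_const_left _ a tendsto_id)).mul
    ((tendsto_gauss_atTop hv).comp (tendsto_atTop_add_const_left _ b tendsto_id))

theorem tendsto_gaussTail_bridge (a b : ℝ) {u v : ℝ} (hu : 0 < u) (hv : 0 < v) :
    Tendsto (fun z => gaussTail (bridge (a + z) u (b + z) v)) atTop (𝓝 0) :=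
  tendsto_gaussTail_atTop.comp (tendsto_bridge_atTop a b hu hv)

/-- The fundamental theorem of calculus on the half-line for a nonnegative derivative; integrability
is automatic, and so is the sign of the result. -/
theorem lintegral_Ioi_of_hasDerivAt {f f' : ℝ → ℝ} {l : ℝ}
    (hd : ∀ z, HasDerivAt f (f' z) z) (h0 : ∀ z, 0 < z → 0 ≤ f' z)
    (hl : Tendsto f atTop (𝓝 l)) :
    0 ≤ l - f 0 ∧ ∫⁻ z in Set.Ioi (0 : ℝ), ENNReal.ofReal (f' z) = ENNReal.ofReal (l - f 0) := by
  have hi := integrableOn_Ioi_deriv_of_nonneg' (a := 0) (fun z _ => hd z) h0 hl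
  rw [← integral_Ioi_of_hasDerivAt_of_nonneg' (a := 0) (fun z _ => hd z) h0 hl]
  refine ⟨setIntegral_nonneg measurableSet_Ioi h0,
    (ofReal_integral_eq_lintegral_ofReal hi ?_).symm⟩
  exact (ae_restrict_iff' measurableSet_Ioi).2 (Eventually.of_forall h0)

/-- The heat kernel of the half-line with the Dirichlet condition at `0`. -/
def dirichlet (x z t : ℝ) : ℝ := gauss (x - z) t - gauss (x + z) t

theorem dirichlet_nonneg {x z t : ℝ} (hx : 0 ≤ x) (hz : 0 ≤ z) (ht : 0 ≤ t) :
    0 ≤ dirichlet x z t :=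
  sub_nonneg.2 (gauss_le_gauss ht (by nlinarith [mul_nonneg hx hz]))

theorem dirichlet_comm (x z t : ℝ) : dirichlet x z t = dirichlet z x t := by
  rw [dirichlet, dirichlet, ← gauss_neg (x - z), neg_sub, add_comm x z]

theorem bridge_neg (a u b v : ℝ) : bridge (-a) u (-b) v = -bridge a u b v := by
  unfold bridge; ring

theorem bridge_comm (a u b v : ℝ) : bridge a u b v = bridge b v a u := by
  unfold bridge
  rw [mul_comm u v, add_comm u v, add_comm (a * v)]

/-- The semigroup property of the Dirichlet heat kernel. -/
theorem lintegral_dirichlet_mul_dirichlet {x y t s : ℝ} (hx : 0 ≤ x) (hy : 0 ≤ y)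
    (ht : 0 < t) (hs : 0 < s) :
    ∫⁻ z in Set.Ioi (0 : ℝ), ENNReal.ofReal (dirichlet x z t * dirichlet z y s) =
      ENNReal.ofReal (dirichlet x y (t + s)) := by
  have h1 := fun z => hasDerivAt_gauss_mul_gauss (-x) (-y) z ht hs
  have h2 := fun z => hasDerivAt_gauss_mul_gauss (-x) y z ht hs
  have h3 := fun z => hasDerivAt_gauss_mul_gauss x (-y) z ht hs
  have h4 := fun z => hasDerivAt_gauss_mul_gauss x y z ht hs
  have hd := fun z => (((h1 z).sub (h2 z)).sub (h3 z)).add (h4 z)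
  have hl : ∀ a b, Tendsto (fun z => -(gauss (a - b) (t + s) *
      gaussTail (bridge (a + z) t (b + z) s))) atTop (𝓝 0) := fun a b => by
    simpa using ((tendsto_gaussTail_bridge a b ht hs).const_mul (gauss (a - b) (t + s))).neg
  have hlim := (((hl (-x) (-y)).sub (hl (-x) y)).sub (hl x (-y))).add (hl x y)
  have e : ∀ z, dirichlet x z t * dirichlet z y s =
      gauss (-x + z) t * gauss (-y + z) s - gauss (-x + z) t * gauss (y + z) s -
        gauss (x + z) t * gauss (-y + z) s + gauss (x + z) t * gauss (y + z) s := fun z => by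
    rw [dirichlet, dirichlet, ← gauss_neg (x - z)]
    ring_nf
  have h0 : ∀ z, 0 < z → 0 ≤ dirichlet x z t * dirichlet z y s := fun z hz =>
    mul_nonneg (dirichlet_nonneg hx hz.le ht.le) (dirichlet_nonneg hz.le hy hs.le)
  simp only [e] at h0 ⊢
  rw [(lintegral_Ioi_of_hasDerivAt hd h0 hlim).2]
  congr 1
  have g1 : gauss (-x + y) (t + s) = gauss (x - y) (t + s) := by
    rw [← gauss_neg]; ring_nf
  have g2 : gauss (-x - y) (t + s) = gauss (x + y) (t + s) := by
    rw [← gauss_neg]; ring_nf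
  have q1 : bridge (-x) t y s = -bridge x t (-y) s := by
    rw [← bridge_neg, neg_neg]
  simp only [Pi.add_apply, Pi.sub_apply, add_zero, g1, g2, bridge_neg, sub_neg_eq_add, q1,
    gaussTail_neg, dirichlet]
  ring

/-- The closed form of `∫_0^∞ dirichlet a z u * hitDensity (b + z) v dz`, see
`lintegral_dirichlet_mul_hitDensity`. -/
def entrance (a u b v : ℝ) : ℝ :=
  hitDensity (a + b) (u + v) * gaussTail (bridge (-a) u b v) +
    hitDensity (a - b) (u + v) * gaussTail (bridge a u b v)

theorem lintegral_dirichlet_mul_hitDensity {a b u v : ℝ} (ha : 0 ≤ a) (hb : 0 ≤ b)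
    (hu : 0 < u) (hv : 0 < v) :
    0 ≤ entrance a u b v ∧
    ∫⁻ z in Set.Ioi (0 : ℝ), ENNReal.ofReal (dirichlet a z u * hitDensity (b + z) v) =
      ENNReal.ofReal (entrance a u b v) := by
  have hd := fun z => (hasDerivAt_gauss_mul_hitDensity (-a) b z hu hv).sub
    (hasDerivAt_gauss_mul_hitDensity a b z hu hv)
  have hl : ∀ a, Tendsto (fun z => hitDensity (a - b) (u + v) *
      gaussTail (bridge (a + z) u (b + z) v) -
        2 * (u / (u + v)) * (gauss (a + z) u * gauss (b + z) v)) atTop (𝓝 0) := fun a => by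
    simpa using ((tendsto_gaussTail_bridge a b hu hv).const_mul (hitDensity (a - b) (u + v))).sub
      ((tendsto_gauss_mul_gauss a b hu hv).const_mul (2 * (u / (u + v))))
  have hlim := (hl (-a)).sub (hl a)
  have e : ∀ z, dirichlet a z u * hitDensity (b + z) v =
      gauss (-a + z) u * hitDensity (b + z) v - gauss (a + z) u * hitDensity (b + z) v :=
    fun z => by
      rw [dirichlet, ← gauss_neg (a - z)]
      ring_nf
  have h0 : ∀ z, 0 < z → 0 ≤ dirichlet a z u * hitDensity (b + z) v := fun z hz =>
    mul_nonneg (dirichlet_nonneg ha hz.le hu.le) (hitDensity_nonneg (by linarith) hv.le)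
  simp only [e] at h0 ⊢
  have g2 : hitDensity (-a - b) (u + v) = -hitDensity (a + b) (u + v) := by
    rw [← hitDensity_neg]; ring_nf
  have hval : entrance a u b v = (0 : ℝ) - 0 -
      ((hitDensity (-a - b) (u + v) * gaussTail (bridge (-a + 0) u (b + 0) v) -
        2 * (u / (u + v)) * (gauss (-a + 0) u * gauss (b + 0) v)) -
      (hitDensity (a - b) (u + v) * gaussTail (bridge (a + 0) u (b + 0) v) -
        2 * (u / (u + v)) * (gauss (a + 0) u * gauss (b + 0) v))) := by
    simp only [add_zero, g2, gauss_neg, entrance]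
    ring
  rw [hval]
  exact lintegral_Ioi_of_hasDerivAt hd h0 hlim

/-- The two orders of composition of `dirichlet` and `hitDensity` are complementary. -/
theorem entrance_add_entrance (a b u v : ℝ) :
    entrance a u b v + entrance b v a u = hitDensity (a + b) (u + v) := by
  have h1 : bridge (-b) v a u = -bridge (-a) u b v := by
    rw [bridge_comm, ← bridge_neg, neg_neg]
  have h2 : hitDensity (b - a) (u + v) = -hitDensity (a - b) (u + v) := by
    rw [← hitDensity_neg, neg_sub]
  simp only [entrance, h1, gaussTail_neg, add_comm v u, add_comm b a, h2, bridge_comm b v a u]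
  ring

/-- The closed form of `∫_0^∞ hitDensity (a + z) u * hitDensity (b + z) v dz`, see
`lintegral_hitDensity_mul_hitDensity`. -/
def hitOverlap (a u b v : ℝ) : ℝ :=
  2 * ((1 / (u + v) - (a - b) ^ 2 / (2 * (u + v) ^ 2)) * gauss (a - b) (u + v)) *
      gaussTail (bridge a u b v) +
    2 * ((a * u + b * v) / (u + v) ^ 2) * (gauss a u * gauss b v)

theorem lintegral_hitDensity_mul_hitDensity {a b u v : ℝ} (ha : 0 ≤ a) (hb : 0 ≤ b)
    (hu : 0 < u) (hv : 0 < v) :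
    0 ≤ hitOverlap a u b v ∧
    ∫⁻ z in Set.Ioi (0 : ℝ), ENNReal.ofReal (hitDensity (a + z) u * hitDensity (b + z) v) =
      ENNReal.ofReal (hitOverlap a u b v) := by
  have hlim : Tendsto (fun z => -(2 * ((1 / (u + v) - (a - b) ^ 2 / (2 * (u + v) ^ 2)) *
          gauss (a - b) (u + v)) * gaussTail (bridge (a + z) u (b + z) v)) -
        2 * (((a + z) * u + (b + z) * v) / (u + v) ^ 2) * (gauss (a + z) u * gauss (b + z) v))
      atTop (𝓝 0) := by
    have hA := tendsto_atTop_add_const_left atTop a tendsto_id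
    have hB := tendsto_atTop_add_const_left atTop b tendsto_id
    have h1 := ((tendsto_hitDensity_atTop hu).comp hA).mul ((tendsto_gauss_atTop hv).comp hB)
    have h2 := ((tendsto_gauss_atTop hu).comp hA).mul ((tendsto_hitDensity_atTop hv).comp hB)
    have h3 := (((tendsto_gaussTail_bridge a b hu hv).const_mul
      (2 * ((1 / (u + v) - (a - b) ^ 2 / (2 * (u + v) ^ 2)) * gauss (a - b) (u + v)))).neg.sub
      (h1.const_mul (2 * u ^ 2 / (u + v) ^ 2))).sub (h2.const_mul (2 * v ^ 2 / (u + v) ^ 2))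
    simp only [mul_zero, neg_zero, sub_zero] at h3
    refine h3.congr fun z => ?_
    simp only [Function.comp, hitDensity, id]
    field_simp
    ring
  have hval : hitOverlap a u b v = 0 -
      (-(2 * ((1 / (u + v) - (a - b) ^ 2 / (2 * (u + v) ^ 2)) *
          gauss (a - b) (u + v)) * gaussTail (bridge (a + 0) u (b + 0) v)) -
        2 * (((a + 0) * u + (b + 0) * v) / (u + v) ^ 2) *
          (gauss (a + 0) u * gauss (b + 0) v)) := by
    simp only [add_zero, hitOverlap]
    ring
  rw [hval]
  exact lintegral_Ioi_of_hasDerivAt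
    (fun z => hasDerivAt_hitDensity_mul_hitDensity a b z hu hv) (fun z hz =>
      mul_nonneg (hitDensity_nonneg (by linarith) hu.le) (hitDensity_nonneg (by linarith) hv.le))
    hlim

/-! ### Splitting the hitting density at an intermediate time -/

theorem hasDerivAt_bridge (a b u v ε τ : ℝ) (hu : 0 < u - τ) (hv : 0 < v + τ) :
    HasDerivAt (fun τ => bridge (ε * (a + τ)) (u - τ) (b - τ) (v + τ))
      ((ε * (v + τ + (a + τ)) - (u - τ) - (b - τ) -
        (ε * (a + τ) * (v + τ) + (b - τ) * (u - τ)) * ((u - τ) - (v + τ)) /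
          (2 * ((u - τ) * (v + τ)))) / (2 * √((u - τ) * (v + τ) * (u + v)))) τ := by
  have hw : 0 < u + v := by linarith
  have hA : HasDerivAt (fun τ => a + τ) 1 τ := (hasDerivAt_id τ).const_add a
  have hV : HasDerivAt (fun τ => v + τ) 1 τ := (hasDerivAt_id τ).const_add v
  have hU : HasDerivAt (fun τ => u - τ) (-1) τ := (hasDerivAt_id τ).const_sub u
  have hB : HasDerivAt (fun τ => b - τ) (-1) τ := (hasDerivAt_id τ).const_sub b
  have hp : 0 < (u - τ) * (v + τ) * (u + v) := by positivity
  have hS := ((hU.mul hV).mul_const (u + v)).sqrt hp.ne'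
  have hN := ((hA.const_mul ε).mul hV).add (hB.mul hU)
  have hS0 : √((u - τ) * (v + τ) * (u + v)) ≠ 0 := by positivity
  have h := hN.div (hS.const_mul 2) (by positivity)
  have e : (fun τ => bridge (ε * (a + τ)) (u - τ) (b - τ) (v + τ)) = fun τ =>
      (ε * (a + τ) * (v + τ) + (b - τ) * (u - τ)) / (2 * √((u - τ) * (v + τ) * (u + v))) := by
    ext τ
    rw [bridge, show u - τ + (v + τ) = u + v by ring]
  rw [e]
  refine h.congr_deriv ?_
  have hsq : √((u - τ) * (v + τ) * (u + v)) ^ 2 = (u - τ) * (v + τ) * (u + v) :=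
    Real.sq_sqrt hp.le
  simp only [Pi.add_apply, Pi.mul_apply]
  generalize √((u - τ) * (v + τ) * (u + v)) = S at *
  have hU0 := hu.ne'
  have hV0 := hv.ne'
  have hw0 := hw.ne'
  generalize u - τ = U at *
  generalize v + τ = V at *
  generalize u + v = W at *
  have hUV : (2 * (U * V)) = 2 * S ^ 2 / W := by
    rw [hsq]; field_simp
  rw [hUV]
  field_simp
  ring

/-- Let boundary time `τ` pass from the second factor to the first, at the expense of interior time.
Then `entrance` grows at the rate at which both factors visit the boundary, the intermediate
position being either in the interior (`hitOverlap`) or at the boundary (the product). -/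
theorem hasDerivAt_entrance (a b u v τ : ℝ) (hu : 0 < u - τ) (hv : 0 < v + τ) :
    HasDerivAt (fun τ => entrance (a + τ) (u - τ) (b - τ) (v + τ))
      (hitOverlap (a + τ) (u - τ) (b - τ) (v + τ) +
        hitDensity (a + τ) (u - τ) * hitDensity (b - τ) (v + τ)) τ := by
  have hw : 0 < u + v := by linarith
  have e : (fun τ => entrance (a + τ) (u - τ) (b - τ) (v + τ)) = fun τ =>
      hitDensity (a + b) (u + v) *
          gaussTail (bridge ((-1) * (a + τ)) (u - τ) (b - τ) (v + τ)) +
        hitDensity (a - b + 2 * τ) (u + v) *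
          gaussTail (bridge (1 * (a + τ)) (u - τ) (b - τ) (v + τ)) := by
    ext τ
    simp only [entrance, one_mul, neg_mul]
    ring_nf
  have h1 := (hasDerivAt_gaussTail _).comp τ (hasDerivAt_bridge a b u v (-1) τ hu hv)
  have h2 := (hasDerivAt_gaussTail _).comp τ (hasDerivAt_bridge a b u v 1 τ hu hv)
  have h3 : HasDerivAt (fun τ => hitDensity (a - b + 2 * τ) (u + v))
      ((1 / (u + v) - (a - b + 2 * τ) ^ 2 / (2 * (u + v) ^ 2)) * gauss (a - b + 2 * τ) (u + v) *
        (2 * 1)) τ := by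
    have h4 : HasDerivAt (fun τ => a - b + 2 * τ) (2 * 1) τ :=
      ((hasDerivAt_id τ).const_mul 2).const_add (a - b)
    exact (hasDerivAt_hitDensity (a - b + 2 * τ) hw).comp τ h4
  rw [e]
  refine ((h1.const_mul _).add (h3.mul h2)).congr_deriv ?_
  have hg1 := gauss_mul_gauss (-1 * (a + τ)) (b - τ) hu hv
  have hg2 := gauss_mul_gauss (1 * (a + τ)) (b - τ) hu hv
  have hS0 : √((u - τ) * (v + τ) * (u + v)) ≠ 0 := by positivity
  have hwτ : u - τ + (v + τ) = u + v := by ring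
  have c1 : gauss (-1 * (a + τ) - (b - τ)) (u + v) = gauss (a + b) (u + v) := by
    rw [← gauss_neg]; ring_nf
  have c2 : gauss (-1 * (a + τ)) (u - τ) = gauss (a + τ) (u - τ) := by
    rw [← gauss_neg]; ring_nf
  have c3 : 1 * (a + τ) - (b - τ) = a - b + 2 * τ := by ring
  have c4 : a + τ - (b - τ) = a - b + 2 * τ := by ring
  rw [hwτ, c1, c2] at hg1
  rw [hwτ, c3, one_mul] at hg2
  simp only [Function.comp, hitOverlap, hitDensity, hwτ, c4, one_mul] at hg2 ⊢
  generalize Real.exp (-bridge (-1 * (a + τ)) (u - τ) (b - τ) (v + τ) ^ 2) / √Real.pi = E1 at *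
  generalize Real.exp (-bridge (a + τ) (u - τ) (b - τ) (v + τ) ^ 2) / √Real.pi = E2 at *
  generalize √((u - τ) * (v + τ) * (u + v)) = S at *
  generalize gaussTail (bridge (a + τ) (u - τ) (b - τ) (v + τ)) = F at *
  have k1 : gauss (a + b) (u + v) * E1 =
      gauss (a + τ) (u - τ) * gauss (b - τ) (v + τ) * (2 * S / (u + v)) := by
    rw [hg1]; field_simp
  have k2 : gauss (a - b + 2 * τ) (u + v) * E2 =
      gauss (a + τ) (u - τ) * gauss (b - τ) (v + τ) * (2 * S / (u + v)) := by
    rw [hg2]; field_simp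
  generalize gauss (a + τ) (u - τ) = A1 at *
  generalize gauss (b - τ) (v + τ) = A2 at *
  generalize gauss (a - b + 2 * τ) (u + v) = A3 at *
  generalize gauss (a + b) (u + v) = A4 at *
  clear hg1 hg2 h1 h2 h3 e c1 c2
  -- `k1` and `k2` eliminate the exponentials; what remains is an identity of rational functions.
  linear_combination (norm := skip)
    (-(a + b) / (u + v) * ((-1 * (v + τ + (a + τ)) - (u - τ) - (b - τ) -
      (-1 * (a + τ) * (v + τ) + (b - τ) * (u - τ)) * (u - τ - (v + τ)) /
        (2 * ((u - τ) * (v + τ)))) / (2 * S))) * k1 +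
    (-(a - b + 2 * τ) / (u + v) * ((v + τ + (a + τ) - (u - τ) - (b - τ) -
      ((a + τ) * (v + τ) + (b - τ) * (u - τ)) * (u - τ - (v + τ)) /
        (2 * ((u - τ) * (v + τ)))) / (2 * S))) * k2
  have hu0 := hu.ne'
  have hv0 := hv.ne'
  have hw0 := hw.ne'
  field_simp
  ring

/-- The fundamental theorem of calculus on an open interval for a nonnegative derivative, with
one-sided limits as boundary values. -/
theorem lintegral_Ioo_of_hasDerivAt {f f' : ℝ → ℝ} {lo hi l r : ℝ} (hlt : lo < hi)
    (hd : ∀ τ ∈ Set.Ioo lo hi, HasDerivAt f (f' τ) τ) (h0 : ∀ τ ∈ Set.Ioo lo hi, 0 ≤ f' τ)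
    (hl : Tendsto f (𝓝[>] lo) (𝓝 l)) (hr : Tendsto f (𝓝[<] hi) (𝓝 r)) :
    0 ≤ r - l ∧ ∫⁻ τ in Set.Ioo lo hi, ENNReal.ofReal (f' τ) = ENNReal.ofReal (r - l) := by
  have hcf : ContinuousOn f (Set.Ioo lo hi) := fun τ hτ => (hd τ hτ).continuousAt.continuousWithinAt
  have hc := continuousOn_Icc_extendFrom_Ioo hcf hl hr
  have hd' : ∀ τ ∈ Set.Ioo lo hi, HasDerivAt (extendFrom (Set.Ioo lo hi) f) (f' τ) τ := by
    intro τ hτ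
    refine (hd τ hτ).congr_of_eventuallyEq ?_
    filter_upwards [Ioo_mem_nhds hτ.1 hτ.2] with σ hσ
    exact extendFrom_eq (subset_closure hσ) ((hd σ hσ).continuousAt.continuousWithinAt)
  have hint := intervalIntegral.integrableOn_deriv_of_nonneg hc hd' h0
  have hv := intervalIntegral.integral_eq_sub_of_hasDerivAt_of_tendsto hlt hd
    ((intervalIntegrable_iff_integrableOn_Ioc_of_le hlt.le).2 hint) hl hr
  rw [intervalIntegral.integral_of_le hlt.le, integral_Ioc_eq_integral_Ioo] at hv
  rw [← hv]
  refine ⟨setIntegral_nonneg measurableSet_Ioo h0, ?_⟩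
  refine (ofReal_integral_eq_lintegral_ofReal (hint.mono_set Set.Ioo_subset_Ioc_self) ?_).symm
  exact (ae_restrict_iff' measurableSet_Ioo).2 (Eventually.of_forall h0)

theorem tendsto_bridge_of_tendsto {l : Filter ℝ} {a u b v : ℝ → ℝ} {a₀ u₀ b₀ : ℝ}
    (ha : Tendsto a l (𝓝 a₀)) (hu : Tendsto u l (𝓝 u₀)) (hb : Tendsto b l (𝓝 b₀))
    (hv : Tendsto v l (𝓝[>] 0)) (hu₀ : 0 < u₀) (hb₀ : 0 < b₀) :
    Tendsto (fun τ => bridge (a τ) (u τ) (b τ) (v τ)) l atTop := by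
  have hv0 : Tendsto v l (𝓝 0) := hv.mono_right nhdsWithin_le_nhds
  have hvp : ∀ᶠ τ in l, 0 < v τ := hv self_mem_nhdsWithin
  have hN : Tendsto (fun τ => a τ * v τ + b τ * u τ) l (𝓝 (a₀ * 0 + b₀ * u₀)) :=
    (ha.mul hv0).add (hb.mul hu)
  have hD : Tendsto (fun τ => 2 * √(u τ * v τ * (u τ + v τ))) l (𝓝[>] 0) := by
    refine tendsto_nhdsWithin_iff.2 ⟨?_, ?_⟩
    · have := (((hu.mul hv0).mul (hu.add hv0)).sqrt).const_mul 2
      simpa using this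
    · filter_upwards [hvp, hu.eventually (lt_mem_nhds hu₀)] with τ h1 h2
      have : 0 < u τ * v τ * (u τ + v τ) := by positivity
      exact Set.mem_Ioi.2 (by positivity)
  have hpos : 0 < a₀ * 0 + b₀ * u₀ := by
    rw [mul_zero, zero_add]
    positivity
  exact (hN.pos_mul_atTop hpos (tendsto_inv_nhdsGT_zero.comp hD)).congr fun τ => by
    simp [bridge, div_eq_mul_inv]

/-- `entrance a u b v` vanishes as `v → 0+` while `b` stays positive. -/
theorem tendsto_entrance_of_tendsto_right {l : Filter ℝ} {a u b v : ℝ → ℝ} {a₀ u₀ b₀ : ℝ}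
    (ha : Tendsto a l (𝓝 a₀)) (hu : Tendsto u l (𝓝 u₀)) (hb : Tendsto b l (𝓝 b₀))
    (hv : Tendsto v l (𝓝[>] 0)) (hu₀ : 0 < u₀) (hb₀ : 0 < b₀) :
    Tendsto (fun τ => entrance (a τ) (u τ) (b τ) (v τ)) l (𝓝 0) := by
  have hv0 : Tendsto v l (𝓝 0) := hv.mono_right nhdsWithin_le_nhds
  have hw : Tendsto (fun τ => u τ + v τ) l (𝓝 u₀) := by simpa using hu.add hv0
  have hK : ∀ {c : ℝ → ℝ} {c₀ : ℝ}, Tendsto c l (𝓝 c₀) →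
      Tendsto (fun τ => hitDensity (c τ) (u τ + v τ)) l (𝓝 (hitDensity c₀ u₀)) := by
    intro c c₀ hc
    unfold hitDensity gauss
    have h4 : 4 * u₀ ≠ 0 := by positivity
    have hs : √(4 * Real.pi * u₀) ≠ 0 := by
      have := Real.pi_pos
      positivity
    exact (hc.div hw hu₀.ne').mul
      ((((hc.pow 2).neg.div (hw.const_mul 4) h4).rexp).div
        ((hw.const_mul (4 * Real.pi)).sqrt) hs)
  have h1 := (hK (ha.add hb)).mul
    (tendsto_gaussTail_atTop.comp (tendsto_bridge_of_tendsto ha.neg hu hb hv hu₀ hb₀))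
  have h2 := (hK (ha.sub hb)).mul
    (tendsto_gaussTail_atTop.comp (tendsto_bridge_of_tendsto ha hu hb hv hu₀ hb₀))
  simpa [entrance, Function.comp_def] using h1.add h2

/-- The composition rule on the level of densities, for a fixed total boundary time `ρ`. Either no
boundary time is spent before the intermediate time, or none after it, or `τ` is spent before and
`ρ - τ` after it. The integrand of the third term is the derivative of `entrance` along the
segment of admissible `τ`; its boundary values cancel the first term and turn the second into the
right-hand side. -/
theorem hitDensity_decomposition {x y t s ρ : ℝ} (hx : 0 ≤ x) (hy : 0 ≤ y) (ht : 0 < t)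
    (hs : 0 < s) (hρ : 0 < ρ) (hρT : ρ < t + s) (hρs : ρ ≠ s) (hρt : ρ ≠ t) :
    (if ρ < s then ENNReal.ofReal (entrance x t (y + ρ) (s - ρ)) else 0) +
      (if ρ < t then ENNReal.ofReal (entrance y s (x + ρ) (t - ρ)) else 0) +
      ∫⁻ τ in Set.Ioo (max 0 (ρ - s)) (min t ρ),
        (ENNReal.ofReal (hitOverlap (x + τ) (t - τ) (y + (ρ - τ)) (s - (ρ - τ))) +
          ENNReal.ofReal (hitDensity (x + τ) (t - τ) * hitDensity (y + (ρ - τ)) (s - (ρ - τ)))) =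
      ENNReal.ofReal (hitDensity (x + y + ρ) (t + s - ρ)) := by
  have hlt : max 0 (ρ - s) < min t ρ := by
    rw [max_lt_iff, lt_min_iff, lt_min_iff]
    exact ⟨⟨ht, hρ⟩, by linarith, by linarith⟩
  set f : ℝ → ℝ := fun τ => entrance (x + τ) (t - τ) (y + (ρ - τ)) (s - (ρ - τ)) with hf
  set f' : ℝ → ℝ := fun τ => hitOverlap (x + τ) (t - τ) (y + (ρ - τ)) (s - (ρ - τ)) +
    hitDensity (x + τ) (t - τ) * hitDensity (y + (ρ - τ)) (s - (ρ - τ)) with hf'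
  have hd : ∀ τ, τ < t → ρ - s < τ → HasDerivAt f (f' τ) τ := by
    intro τ h1 h2
    have := hasDerivAt_entrance x (y + ρ) t (s - ρ) τ (by linarith) (by linarith)
    have e1 : ∀ τ, y + ρ - τ = y + (ρ - τ) := fun τ => by ring
    have e2 : ∀ τ, s - ρ + τ = s - (ρ - τ) := fun τ => by ring
    simp only [e1, e2] at this
    exact this
  have hmem : ∀ τ ∈ Set.Ioo (max 0 (ρ - s)) (min t ρ),
      0 < τ ∧ ρ - s < τ ∧ τ < t ∧ τ < ρ := fun τ hτ =>
    ⟨(max_lt_iff.1 hτ.1).1, (max_lt_iff.1 hτ.1).2, (lt_min_iff.1 hτ.2).1, (lt_min_iff.1 hτ.2).2⟩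
  have hov : ∀ τ ∈ Set.Ioo (max 0 (ρ - s)) (min t ρ),
      0 ≤ hitOverlap (x + τ) (t - τ) (y + (ρ - τ)) (s - (ρ - τ)) ∧
      0 ≤ hitDensity (x + τ) (t - τ) * hitDensity (y + (ρ - τ)) (s - (ρ - τ)) := by
    intro τ hτ
    obtain ⟨h1, h2, h3, h4⟩ := hmem τ hτ
    exact ⟨(lintegral_hitDensity_mul_hitDensity (by linarith) (by linarith) (by linarith)
      (by linarith)).1, mul_nonneg (hitDensity_nonneg (by linarith) (by linarith))
        (hitDensity_nonneg (by linarith) (by linarith))⟩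
  have hint : (∫⁻ τ in Set.Ioo (max 0 (ρ - s)) (min t ρ),
        (ENNReal.ofReal (hitOverlap (x + τ) (t - τ) (y + (ρ - τ)) (s - (ρ - τ))) +
          ENNReal.ofReal (hitDensity (x + τ) (t - τ) * hitDensity (y + (ρ - τ)) (s - (ρ - τ))))) =
      ∫⁻ τ in Set.Ioo (max 0 (ρ - s)) (min t ρ), ENNReal.ofReal (f' τ) :=
    setLIntegral_congr_fun measurableSet_Ioo fun τ hτ =>
      (ENNReal.ofReal_add (hov τ hτ).1 (hov τ hτ).2).symm
  rw [hint]
  have ca : Continuous fun τ : ℝ => x + τ := by fun_prop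
  have cb : Continuous fun τ : ℝ => y + (ρ - τ) := by fun_prop
  have cu : Continuous fun τ : ℝ => t - τ := by fun_prop
  have cv : Continuous fun τ : ℝ => s - (ρ - τ) := by fun_prop
  obtain ⟨l, hl, hl0, hleq⟩ : ∃ l, Tendsto f (𝓝[>] (max 0 (ρ - s))) (𝓝 l) ∧ 0 ≤ l ∧
      (if ρ < s then ENNReal.ofReal (entrance x t (y + ρ) (s - ρ)) else 0) =
        ENNReal.ofReal l := by
    rcases lt_or_gt_of_ne hρs with h | h
    · refine ⟨entrance x t (y + ρ) (s - ρ), ?_,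
        (lintegral_dirichlet_mul_hitDensity hx (by linarith) ht (by linarith)).1, by simp [h]⟩
      rw [max_eq_left (by linarith)]
      have := (hd 0 ht (by linarith)).continuousAt.tendsto
      simp only [hf, add_zero, sub_zero] at this
      exact this.mono_left nhdsWithin_le_nhds
    · refine ⟨0, ?_, le_rfl, by simp [h.le]⟩
      rw [max_eq_right (by linarith)]
      refine tendsto_entrance_of_tendsto_right (ca.continuousWithinAt) (cu.continuousWithinAt)
        (cb.continuousWithinAt) ?_ (by linarith) (by linarith)
      refine tendsto_nhdsWithin_iff.2 ⟨?_, ?_⟩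
      · simpa using (cv.tendsto (ρ - s)).mono_left nhdsWithin_le_nhds
      · filter_upwards [self_mem_nhdsWithin] with τ hτ
        simp only [Set.mem_Ioi] at hτ ⊢
        linarith
  have hsum : ∀ τ, entrance (x + τ) (t - τ) (y + (ρ - τ)) (s - (ρ - τ)) =
      hitDensity (x + y + ρ) (t + s - ρ) -
        entrance (y + (ρ - τ)) (s - (ρ - τ)) (x + τ) (t - τ) := by
    intro τ
    have := entrance_add_entrance (x + τ) (y + (ρ - τ)) (t - τ) (s - (ρ - τ))
    rw [show x + τ + (y + (ρ - τ)) = x + y + ρ by ring,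
      show t - τ + (s - (ρ - τ)) = t + s - ρ by ring] at this
    linarith
  obtain ⟨r, hr, hr0, hreq⟩ : ∃ r, Tendsto f (𝓝[<] (min t ρ))
      (𝓝 (hitDensity (x + y + ρ) (t + s - ρ) - r)) ∧ 0 ≤ r ∧
      (if ρ < t then ENNReal.ofReal (entrance y s (x + ρ) (t - ρ)) else 0) =
        ENNReal.ofReal r := by
    rcases lt_or_gt_of_ne hρt with h | h
    · refine ⟨entrance y s (x + ρ) (t - ρ), ?_,
        (lintegral_dirichlet_mul_hitDensity hy (by linarith) hs (by linarith)).1, by simp [h]⟩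
      rw [min_eq_right h.le]
      have := (hd ρ h (by linarith)).continuousAt.tendsto
      have hfρ : f ρ = hitDensity (x + y + ρ) (t + s - ρ) - entrance y s (x + ρ) (t - ρ) := by
        simp only [hf, hsum ρ, sub_self, add_zero, sub_zero]
      rw [hfρ] at this
      exact this.mono_left nhdsWithin_le_nhds
    · refine ⟨0, ?_, le_rfl, by simp [h.le]⟩
      rw [min_eq_left h.le]
      simp only [hf, hsum]
      refine Tendsto.const_sub _ ?_
      refine tendsto_entrance_of_tendsto_right (cb.continuousWithinAt) (cv.continuousWithinAt)
        (ca.continuousWithinAt) ?_ (by linarith) (by linarith)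
      refine tendsto_nhdsWithin_iff.2 ⟨?_, ?_⟩
      · simpa using (cu.tendsto t).mono_left nhdsWithin_le_nhds
      · filter_upwards [self_mem_nhdsWithin] with τ hτ
        simp only [Set.mem_Ioi, Set.mem_Iio] at hτ ⊢
        linarith
  obtain ⟨h0, hI⟩ := lintegral_Ioo_of_hasDerivAt hlt
    (fun τ hτ => hd τ (hmem τ hτ).2.2.1 (hmem τ hτ).2.1)
    (fun τ hτ => add_nonneg (hov τ hτ).1 (hov τ hτ).2) hl hr
  rw [hI, hleq, hreq, ← ENNReal.ofReal_add hl0 hr0, ← ENNReal.ofReal_add (by positivity) h0]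
  congr 1
  ring

/-! ### The law of the boundary time and its composition rule -/

@[fun_prop]
theorem measurable_hitDensity_comp {α : Type*} [MeasurableSpace α] {f g : α → ℝ}
    (hf : Measurable f) (hg : Measurable g) : Measurable fun x => hitDensity (f x) (g x) := by
  unfold hitDensity gauss; fun_prop

@[fun_prop]
theorem measurable_dirichlet_comp {α : Type*} [MeasurableSpace α] {f g h : α → ℝ}
    (hf : Measurable f) (hg : Measurable g) (hh : Measurable h) :
    Measurable fun x => dirichlet (f x) (g x) (h x) := by
  unfold dirichlet gauss; fun_prop

@[fun_prop]
theorem measurable_entrance_comp {α : Type*} [MeasurableSpace α] {f g h k : α → ℝ}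
    (hf : Measurable f) (hg : Measurable g) (hh : Measurable h) (hk : Measurable k) :
    Measurable fun x => entrance (f x) (g x) (h x) (k x) := by
  have := continuous_gaussTail.measurable
  unfold entrance bridge; fun_prop

@[fun_prop]
theorem measurable_hitOverlap_comp {α : Type*} [MeasurableSpace α] {f g h k : α → ℝ}
    (hf : Measurable f) (hg : Measurable g) (hh : Measurable h) (hk : Measurable k) :
    Measurable fun x => hitOverlap (f x) (g x) (h x) (k x) := by
  have := continuous_gaussTail.measurable
  unfold hitOverlap bridge gauss; fun_prop

/-- The distribution of the time that the process with kernel `kernelG` spends at the boundary up to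
time `t`, on paths from normal coordinate `a` to normal coordinate `c`. The atom at `0` carries
the paths that avoid the boundary; it disappears if `a` or `c` is zero. -/
def sojourn (a c t : ℝ) : Measure ℝ :=
  ENNReal.ofReal (dirichlet a c t) • Measure.dirac 0 +
    (volume.restrict (Set.Ioo 0 t)).withDensity
      fun τ => ENNReal.ofReal (hitDensity (a + c + τ) (t - τ))

theorem lintegral_sojourn (a c t : ℝ) {φ : ℝ → ℝ≥0∞} (hφ : Measurable φ) :
    ∫⁻ τ, φ τ ∂sojourn a c t = ENNReal.ofReal (dirichlet a c t) * φ 0 +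
      ∫⁻ τ in Set.Ioo 0 t, ENNReal.ofReal (hitDensity (a + c + τ) (t - τ)) * φ τ := by
  rw [sojourn, lintegral_add_measure, lintegral_smul_measure, lintegral_dirac' _ hφ,
    lintegral_withDensity_eq_lintegral_mul _ (by fun_prop) hφ]
  rfl

instance (a c t : ℝ) : SFinite (sojourn a c t) := by
  unfold sojourn; infer_instance

theorem ae_sojourn (a c : ℝ) {t : ℝ} (ht : 0 < t) : ∀ᵐ τ ∂sojourn a c t, 0 ≤ τ ∧ τ < t := by
  refine ae_add_measure_iff.2 ⟨Measure.ae_smul_measure ?_ _, ?_⟩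
  · exact (ae_dirac_iff (by measurability)).2 ⟨le_rfl, ht⟩
  · refine (withDensity_absolutelyContinuous _ _).ae_le ?_
    filter_upwards [ae_restrict_mem measurableSet_Ioo] with τ hτ using ⟨hτ.1.le, hτ.2⟩

/-- The substitution `ρ = τ + σ` on a rectangle. -/
theorem lintegral_Ioo_Ioo_eq_add {t s : ℝ} {F : ℝ → ℝ → ℝ≥0∞}
    (hF : Measurable (Function.uncurry F)) :
    ∫⁻ τ in Set.Ioo 0 t, ∫⁻ σ in Set.Ioo 0 s, F τ σ =
      ∫⁻ ρ in Set.Ioo 0 (t + s), ∫⁻ τ in Set.Ioo (max 0 (ρ - s)) (min t ρ), F τ (ρ - τ) := by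
  set S : Set (ℝ × ℝ) := Set.Ioo 0 t ×ˢ Set.Ioo 0 s with hS
  have hSm : MeasurableSet S := measurableSet_Ioo.prod measurableSet_Ioo
  have hG : Measurable (S.indicator (Function.uncurry F)) := hF.indicator hSm
  have h1 : ∫⁻ τ in Set.Ioo 0 t, ∫⁻ σ in Set.Ioo 0 s, F τ σ =
      ∫⁻ τ, ∫⁻ σ, S.indicator (Function.uncurry F) (τ, σ) := by
    rw [← lintegral_indicator measurableSet_Ioo]
    refine lintegral_congr fun τ => ?_
    by_cases hτ : τ ∈ Set.Ioo 0 t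
    · rw [Set.indicator_of_mem hτ, ← lintegral_indicator measurableSet_Ioo]
      refine lintegral_congr fun σ => ?_
      by_cases hσ : σ ∈ Set.Ioo 0 s
      · rw [Set.indicator_of_mem hσ, Set.indicator_of_mem (Set.mk_mem_prod hτ hσ)]; rfl
      · rw [Set.indicator_of_notMem hσ, Set.indicator_of_notMem fun h => hσ h.2]
    · rw [Set.indicator_of_notMem hτ]
      simp only [Set.indicator_of_notMem (show ∀ {σ}, (τ, σ) ∉ S from fun h => hτ h.1),
        lintegral_zero]
  have h2 : ∀ τ, ∫⁻ σ, S.indicator (Function.uncurry F) (τ, σ) =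
      ∫⁻ ρ, S.indicator (Function.uncurry F) (τ, ρ - τ) := fun τ =>
    (lintegral_sub_right_eq_self (fun σ => S.indicator (Function.uncurry F) (τ, σ)) τ).symm
  have hG' : Measurable fun p : ℝ × ℝ => S.indicator (Function.uncurry F) (p.1, p.2 - p.1) :=
    hG.comp (by fun_prop)
  rw [h1]
  simp only [h2]
  rw [lintegral_lintegral_swap hG'.aemeasurable, ← lintegral_indicator measurableSet_Ioo]
  refine lintegral_congr fun ρ => ?_
  have hmem : ∀ τ, (τ, ρ - τ) ∈ S ↔ τ ∈ Set.Ioo (max 0 (ρ - s)) (min t ρ) := by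
    intro τ
    simp only [hS, Set.mem_prod, Set.mem_Ioo, max_lt_iff, lt_min_iff]
    constructor
    · rintro ⟨⟨h1, h2⟩, h3, h4⟩
      exact ⟨⟨h1, by linarith⟩, h2, by linarith⟩
    · rintro ⟨⟨h1, h2⟩, h3, h4⟩
      exact ⟨⟨h1, h3⟩, by linarith, by linarith⟩
  have h3 : ∫⁻ τ, S.indicator (Function.uncurry F) (τ, ρ - τ) =
      ∫⁻ τ in Set.Ioo (max 0 (ρ - s)) (min t ρ), F τ (ρ - τ) := by
    rw [← lintegral_indicator measurableSet_Ioo]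
    refine lintegral_congr fun τ => ?_
    by_cases hτ : τ ∈ Set.Ioo (max 0 (ρ - s)) (min t ρ)
    · rw [Set.indicator_of_mem hτ, Set.indicator_of_mem ((hmem τ).2 hτ)]; rfl
    · rw [Set.indicator_of_notMem hτ, Set.indicator_of_notMem (mt (hmem τ).1 hτ)]
  rw [h3]
  by_cases hρ : ρ ∈ Set.Ioo 0 (t + s)
  · rw [Set.indicator_of_mem hρ]
  · rw [Set.indicator_of_notMem hρ]
    have : Set.Ioo (max 0 (ρ - s)) (min t ρ) = ∅ := by
      refine Set.eq_empty_of_forall_notMem fun τ hτ => hρ ?_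
      have h1 := max_lt_iff.1 hτ.1
      have h2 := lt_min_iff.1 hτ.2
      exact ⟨by linarith, by linarith⟩
    simp [this]

theorem lintegral_sojourn_sojourn (a z c t s : ℝ) {φ : ℝ → ℝ≥0∞} (hφ : Measurable φ) :
    ∫⁻ τ, ∫⁻ σ, φ (τ + σ) ∂sojourn z c s ∂sojourn a z t =
      ENNReal.ofReal (dirichlet a z t) * ENNReal.ofReal (dirichlet z c s) * φ 0 +
      (∫⁻ σ in Set.Ioo 0 s, ENNReal.ofReal (dirichlet a z t) *
        ENNReal.ofReal (hitDensity (z + c + σ) (s - σ)) * φ σ) +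
      (∫⁻ τ in Set.Ioo 0 t, ENNReal.ofReal (dirichlet z c s) *
        ENNReal.ofReal (hitDensity (a + z + τ) (t - τ)) * φ τ) +
      ∫⁻ τ in Set.Ioo 0 t, ∫⁻ σ in Set.Ioo 0 s, ENNReal.ofReal (hitDensity (a + z + τ) (t - τ)) *
        ENNReal.ofReal (hitDensity (z + c + σ) (s - σ)) * φ (τ + σ) := by
  have h1 : ∀ τ, ∫⁻ σ, φ (τ + σ) ∂sojourn z c s =
      ENNReal.ofReal (dirichlet z c s) * φ τ + ∫⁻ σ in Set.Ioo 0 s,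
        ENNReal.ofReal (hitDensity (z + c + σ) (s - σ)) * φ (τ + σ) := fun τ => by
    rw [lintegral_sojourn _ _ _ (φ := fun σ => φ (τ + σ)) (by fun_prop), add_zero]
  have hm : Measurable fun τ => ∫⁻ σ in Set.Ioo 0 s,
        ENNReal.ofReal (hitDensity (z + c + σ) (s - σ)) * φ (τ + σ) :=
    Measurable.lintegral_prod_right' (f := fun p : ℝ × ℝ =>
      ENNReal.ofReal (hitDensity (z + c + p.2) (s - p.2)) * φ (p.1 + p.2)) (by fun_prop)
  simp only [h1]
  rw [lintegral_sojourn _ _ _ (by fun_prop)]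
  simp only [zero_add, mul_add]
  rw [lintegral_add_left (by fun_prop), ← lintegral_const_mul _ (by fun_prop)]
  have h2 : ∀ τ, ENNReal.ofReal (hitDensity (a + z + τ) (t - τ)) * ∫⁻ σ in Set.Ioo 0 s,
        ENNReal.ofReal (hitDensity (z + c + σ) (s - σ)) * φ (τ + σ) =
      ∫⁻ σ in Set.Ioo 0 s, ENNReal.ofReal (hitDensity (a + z + τ) (t - τ)) *
        ENNReal.ofReal (hitDensity (z + c + σ) (s - σ)) * φ (τ + σ) := fun τ => by
    rw [← lintegral_const_mul _ (by fun_prop)]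
    simp only [mul_assoc]
  simp only [h2, ← mul_assoc, ← add_assoc, mul_comm (ENNReal.ofReal (hitDensity (a + z + _) _))
    (ENNReal.ofReal (dirichlet z c s))]

theorem lintegral_indicator_Ioo {s T : ℝ} (hs : s ≤ T) (f : ℝ → ℝ≥0∞) :
    ∫⁻ ρ in Set.Ioo 0 s, f ρ = ∫⁻ ρ in Set.Ioo 0 T, if ρ < s then f ρ else 0 := by
  rw [← lintegral_indicator measurableSet_Ioo, ← lintegral_indicator measurableSet_Ioo]
  refine lintegral_congr fun ρ => ?_
  simp only [Set.indicator_apply, Set.mem_Ioo]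
  by_cases h0 : 0 < ρ <;> by_cases h1 : ρ < s <;> simp [h0, h1]
  intro h; linarith

/-- The boundary times before and after an intermediate time add up. The interior of the half-line
carries Lebesgue measure and its end point a unit mass. -/
theorem sojourn_semigroup {a c t s : ℝ} (ha : 0 ≤ a) (hc : 0 ≤ c) (ht : 0 < t) (hs : 0 < s)
    {φ : ℝ → ℝ≥0∞} (hφ : Measurable φ) :
    (∫⁻ z in Set.Ioi (0 : ℝ), ∫⁻ τ, ∫⁻ σ, φ (τ + σ) ∂sojourn z c s ∂sojourn a z t) +
      ∫⁻ τ, ∫⁻ σ, φ (τ + σ) ∂sojourn 0 c s ∂sojourn a 0 t =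
      ∫⁻ τ, φ τ ∂sojourn a c (t + s) := by
  have hd0 : dirichlet a 0 t = 0 := by simp [dirichlet]
  have hd0' : dirichlet 0 c s = 0 := by rw [dirichlet_comm]; simp [dirichlet]
  simp only [lintegral_sojourn_sojourn _ _ _ _ _ hφ, hd0, hd0', ENNReal.ofReal_zero, zero_mul,
    lintegral_zero, zero_add]
  rw [lintegral_sojourn _ _ _ hφ]
  have m1 : Measurable fun z => ∫⁻ σ in Set.Ioo 0 s, ENNReal.ofReal (dirichlet a z t) *
        ENNReal.ofReal (hitDensity (z + c + σ) (s - σ)) * φ σ :=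
    Measurable.lintegral_prod_right' (f := fun p : ℝ × ℝ => ENNReal.ofReal (dirichlet a p.1 t) *
        ENNReal.ofReal (hitDensity (p.1 + c + p.2) (s - p.2)) * φ p.2) (by fun_prop)
  have m2 : Measurable fun z => ∫⁻ τ in Set.Ioo 0 t, ENNReal.ofReal (dirichlet z c s) *
        ENNReal.ofReal (hitDensity (a + z + τ) (t - τ)) * φ τ :=
    Measurable.lintegral_prod_right' (f := fun p : ℝ × ℝ => ENNReal.ofReal (dirichlet p.1 c s) *
        ENNReal.ofReal (hitDensity (a + p.1 + p.2) (t - p.2)) * φ p.2) (by fun_prop)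
  rw [lintegral_add_left (by fun_prop), lintegral_add_left (by fun_prop),
    lintegral_add_left (by fun_prop), lintegral_mul_const _ (by fun_prop)]
  -- `e1` to `e5`: no boundary time at all, none before the intermediate time, none after it, and
  -- some on both sides with the intermediate position in the interior or at the boundary.
  have e1 : ∫⁻ z in Set.Ioi (0 : ℝ), ENNReal.ofReal (dirichlet a z t) *
      ENNReal.ofReal (dirichlet z c s) = ENNReal.ofReal (dirichlet a c (t + s)) := by
    rw [← lintegral_dirichlet_mul_dirichlet ha hc ht hs]
    refine setLIntegral_congr_fun measurableSet_Ioi fun z hz => ?_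
    exact (ENNReal.ofReal_mul (dirichlet_nonneg ha (le_of_lt hz) ht.le)).symm
  have e2 : ∫⁻ z in Set.Ioi (0 : ℝ), ∫⁻ σ in Set.Ioo 0 s, ENNReal.ofReal (dirichlet a z t) *
        ENNReal.ofReal (hitDensity (z + c + σ) (s - σ)) * φ σ =
      ∫⁻ σ in Set.Ioo 0 s, ENNReal.ofReal (entrance a t (c + σ) (s - σ)) * φ σ := by
    rw [lintegral_lintegral_swap (by fun_prop)]
    refine setLIntegral_congr_fun measurableSet_Ioo fun σ hσ => ?_
    rw [lintegral_mul_const _ (by fun_prop), ← (lintegral_dirichlet_mul_hitDensity ha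
      (add_nonneg hc hσ.1.le) ht (sub_pos.2 hσ.2)).2]
    congr 1
    refine setLIntegral_congr_fun measurableSet_Ioi fun z hz => ?_
    rw [← ENNReal.ofReal_mul (dirichlet_nonneg ha (le_of_lt hz) ht.le),
      show z + c + σ = c + σ + z by ring]
  have e3 : ∫⁻ z in Set.Ioi (0 : ℝ), ∫⁻ τ in Set.Ioo 0 t, ENNReal.ofReal (dirichlet z c s) *
        ENNReal.ofReal (hitDensity (a + z + τ) (t - τ)) * φ τ =
      ∫⁻ τ in Set.Ioo 0 t, ENNReal.ofReal (entrance c s (a + τ) (t - τ)) * φ τ := by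
    rw [lintegral_lintegral_swap (by fun_prop)]
    refine setLIntegral_congr_fun measurableSet_Ioo fun τ hτ => ?_
    rw [lintegral_mul_const _ (by fun_prop), ← (lintegral_dirichlet_mul_hitDensity hc
      (add_nonneg ha hτ.1.le) hs (sub_pos.2 hτ.2)).2]
    congr 1
    refine setLIntegral_congr_fun measurableSet_Ioi fun z hz => ?_
    rw [dirichlet_comm z c, ← ENNReal.ofReal_mul (dirichlet_nonneg hc (le_of_lt hz) hs.le),
      show a + z + τ = a + τ + z by ring]
  have e4 : (∫⁻ z in Set.Ioi (0 : ℝ), ∫⁻ τ in Set.Ioo 0 t, ∫⁻ σ in Set.Ioo 0 s,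
      ENNReal.ofReal (hitDensity (a + z + τ) (t - τ)) *
        ENNReal.ofReal (hitDensity (z + c + σ) (s - σ)) * φ (τ + σ)) =
      ∫⁻ τ in Set.Ioo 0 t, ∫⁻ σ in Set.Ioo 0 s,
        ENNReal.ofReal (hitOverlap (a + τ) (t - τ) (c + σ) (s - σ)) * φ (τ + σ) := by
    have m3 : Measurable fun p : ℝ × ℝ => ∫⁻ σ in Set.Ioo 0 s,
        ENNReal.ofReal (hitDensity (a + p.1 + p.2) (t - p.2)) *
        ENNReal.ofReal (hitDensity (p.1 + c + σ) (s - σ)) * φ (p.2 + σ) :=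
      Measurable.lintegral_prod_right' (f := fun q : (ℝ × ℝ) × ℝ =>
        ENNReal.ofReal (hitDensity (a + q.1.1 + q.1.2) (t - q.1.2)) *
        ENNReal.ofReal (hitDensity (q.1.1 + c + q.2) (s - q.2)) * φ (q.1.2 + q.2)) (by fun_prop)
    rw [lintegral_lintegral_swap m3.aemeasurable]
    refine setLIntegral_congr_fun measurableSet_Ioo fun τ hτ => ?_
    rw [lintegral_lintegral_swap (by fun_prop)]
    refine setLIntegral_congr_fun measurableSet_Ioo fun σ hσ => ?_
    rw [lintegral_mul_const _ (by fun_prop), ← (lintegral_hitDensity_mul_hitDensity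
      (add_nonneg ha hτ.1.le) (add_nonneg hc hσ.1.le) (sub_pos.2 hτ.2) (sub_pos.2 hσ.2)).2]
    congr 1
    refine setLIntegral_congr_fun measurableSet_Ioi fun z hz => ?_
    simp only [Set.mem_Ioi] at hz ⊢
    rw [← ENNReal.ofReal_mul (hitDensity_nonneg (by linarith [hτ.1]) (by linarith [hτ.2])),
      show z + c + σ = c + σ + z by ring, show a + z + τ = a + τ + z by ring]
  have e5 : ∫⁻ τ in Set.Ioo 0 t, ∫⁻ σ in Set.Ioo 0 s,
      ENNReal.ofReal (hitDensity (a + 0 + τ) (t - τ)) *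
        ENNReal.ofReal (hitDensity (c + σ) (s - σ)) * φ (τ + σ) =
      ∫⁻ τ in Set.Ioo 0 t, ∫⁻ σ in Set.Ioo 0 s,
        ENNReal.ofReal (hitDensity (a + τ) (t - τ) * hitDensity (c + σ) (s - σ)) * φ (τ + σ) := by
    refine setLIntegral_congr_fun measurableSet_Ioo fun τ hτ => ?_
    simp only [add_zero]
    refine lintegral_congr fun σ => ?_
    rw [ENNReal.ofReal_mul (hitDensity_nonneg (by linarith [hτ.1]) (by linarith [hτ.2]))]
  rw [e1, e2, e3, e4, e5, add_assoc, add_assoc, add_assoc]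
  congr 1
  rw [lintegral_Ioo_Ioo_eq_add (F := fun τ σ =>
      ENNReal.ofReal (hitOverlap (a + τ) (t - τ) (c + σ) (s - σ)) * φ (τ + σ))
      (by unfold Function.uncurry; fun_prop),
    lintegral_Ioo_Ioo_eq_add (F := fun τ σ =>
      ENNReal.ofReal (hitDensity (a + τ) (t - τ) * hitDensity (c + σ) (s - σ)) * φ (τ + σ))
      (by unfold Function.uncurry; fun_prop),
    lintegral_indicator_Ioo (show s ≤ t + s by linarith),
    lintegral_indicator_Ioo (show t ≤ t + s by linarith)]
  simp only [add_sub_cancel]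
  have m4 : Measurable fun ρ => if ρ < s then
      ENNReal.ofReal (entrance a t (c + ρ) (s - ρ)) * φ ρ else 0 :=
    Measurable.ite measurableSet_Iio (by fun_prop) (by fun_prop)
  have m5 : Measurable fun ρ => if ρ < t then
      ENNReal.ofReal (entrance c s (a + ρ) (t - ρ)) * φ ρ else 0 :=
    Measurable.ite measurableSet_Iio (by fun_prop) (by fun_prop)
  have m6 : Measurable fun ρ => ∫⁻ τ in Set.Ioo (max 0 (ρ - s)) (min t ρ),
      ENNReal.ofReal (hitOverlap (a + τ) (t - τ) (c + (ρ - τ)) (s - (ρ - τ))) * φ ρ := by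
    have hset : MeasurableSet {p : ℝ × ℝ | p.2 ∈ Set.Ioo (max 0 (p.1 - s)) (min t p.1)} :=
      MeasurableSet.inter
        (measurableSet_lt (f := fun p : ℝ × ℝ => max 0 (p.1 - s)) (by fun_prop) measurable_snd)
        (measurableSet_lt (g := fun p : ℝ × ℝ => min t p.1) measurable_snd (by fun_prop))
    have := Measurable.lintegral_prod_right' (ν := (volume : Measure ℝ))
      (f := {p : ℝ × ℝ | p.2 ∈ Set.Ioo (max 0 (p.1 - s)) (min t p.1)}.indicator fun p =>
        ENNReal.ofReal (hitOverlap (a + p.2) (t - p.2) (c + (p.1 - p.2)) (s - (p.1 - p.2))) *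
          φ p.1) (Measurable.indicator (by fun_prop) hset)
    refine (congrArg Measurable (funext fun ρ => ?_)).mp this
    rw [← lintegral_indicator measurableSet_Ioo]
    exact lintegral_congr fun τ => rfl
  rw [← lintegral_add_left m6, ← lintegral_add_left m5, ← lintegral_add_left m4]
  refine lintegral_congr_ae ?_
  rw [EventuallyEq, ae_restrict_iff' measurableSet_Ioo]
  have hne : ∀ r : ℝ, ∀ᵐ ρ : ℝ, ρ ≠ r := fun r => by
    simp [ae_iff]
  filter_upwards [hne s, hne t] with ρ h1 h2 hρ
  rw [← hitDensity_decomposition ha hc ht hs hρ.1 hρ.2 h1 h2, lintegral_mul_const _ (by fun_prop),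
    lintegral_mul_const _ (by fun_prop), lintegral_add_left (by fun_prop), add_mul, add_mul,
    add_mul]
  simp only [ite_mul, zero_mul, add_assoc]

/-! ### Total mass and the Gauss semigroup on `ℝ^d` -/

theorem hasDerivAt_gaussTail_scaled (c z : ℝ) {t : ℝ} (ht : 0 < t) :
    HasDerivAt (fun z => -gaussTail ((z + c) / (2 * √t))) (gauss (z + c) t) z := by
  have h : HasDerivAt (fun z => (z + c) / (2 * √t)) (1 / (2 * √t)) z :=
    ((hasDerivAt_id z).add_const c).div_const _
  refine ((hasDerivAt_gaussTail _).comp z h).neg.congr_deriv ?_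
  have e : -((z + c) / (2 * √t)) ^ 2 = -(z + c) ^ 2 / (4 * t) := by
    rw [div_pow, mul_pow, Real.sq_sqrt ht.le]
    ring
  have hpi := Real.pi_pos
  rw [gauss, e, show 4 * Real.pi * t = 2 ^ 2 * (Real.pi * t) by ring,
    Real.sqrt_mul (by positivity), Real.sqrt_sq (by norm_num), Real.sqrt_mul hpi.le]
  field_simp

theorem lintegral_dirichlet {a t : ℝ} (ha : 0 ≤ a) (ht : 0 < t) :
    0 ≤ 1 - 2 * gaussTail (a / (2 * √t)) ∧
    ∫⁻ z in Set.Ioi (0 : ℝ), ENNReal.ofReal (dirichlet a z t) =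
      ENNReal.ofReal (1 - 2 * gaussTail (a / (2 * √t))) := by
  have hd := fun z => (hasDerivAt_gaussTail_scaled (-a) z ht).sub
    (hasDerivAt_gaussTail_scaled a z ht)
  have hl : ∀ c, Tendsto (fun z => -gaussTail ((z + c) / (2 * √t))) atTop (𝓝 0) := fun c => by
    have h2 : 0 < 2 * √t := by positivity
    simpa using (tendsto_gaussTail_atTop.comp
      ((tendsto_atTop_add_const_right _ c tendsto_id).atTop_div_const h2)).neg
  have e : ∀ z, dirichlet a z t = gauss (z + -a) t - gauss (z + a) t := fun z => by
    rw [dirichlet, ← gauss_neg (a - z)]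
    ring_nf
  have h0 : ∀ z, 0 < z → 0 ≤ dirichlet a z t := fun z hz => dirichlet_nonneg ha hz.le ht.le
  simp only [e] at h0 ⊢
  have := lintegral_Ioi_of_hasDerivAt hd h0 ((hl (-a)).sub (hl a))
  have hv : (0 : ℝ) - 0 - ((fun z => -gaussTail ((z + -a) / (2 * √t))) -
      fun z => -gaussTail ((z + a) / (2 * √t))) 0 = 1 - 2 * gaussTail (a / (2 * √t)) := by
    simp only [Pi.sub_apply, zero_add, neg_div, gaussTail_neg]
    ring
  rwa [hv] at this

theorem lintegral_hitDensity {a t : ℝ} (ha : 0 ≤ a) (ht : 0 < t) :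
    ∫⁻ z in Set.Ioi (0 : ℝ), ENNReal.ofReal (hitDensity (a + z) t) =
      ENNReal.ofReal (2 * gauss a t) := by
  have hd : ∀ z, HasDerivAt (fun z => (-2) * gauss (a + z) t) (hitDensity (a + z) t) z :=
    fun z => (((hasDerivAt_gauss (a + z) ht).comp_const_add a z).const_mul (-2)).congr_deriv
      (by ring)
  have hl : Tendsto (fun z => (-2) * gauss (a + z) t) atTop (𝓝 0) := by
    simpa using ((tendsto_gauss_atTop ht).comp
      (tendsto_atTop_add_const_left _ a tendsto_id)).const_mul (-2)
  rw [(lintegral_Ioi_of_hasDerivAt hd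
    (fun z hz => hitDensity_nonneg (by linarith) ht.le) hl).2]
  simp

/-- The integrand is the derivative of `-2 * gaussTail ((a + τ) / (2 * √(t - τ)))` in `τ`. -/
theorem lintegral_gauss_add_hitDensity {a t : ℝ} (ha : 0 ≤ a) (ht : 0 < t) :
    0 ≤ 2 * gaussTail (a / (2 * √t)) ∧
    ∫⁻ τ in Set.Ioo 0 t,
      ENNReal.ofReal (2 * gauss (a + τ) (t - τ) + hitDensity (a + τ) (t - τ)) =
      ENNReal.ofReal (2 * gaussTail (a / (2 * √t))) := by
  set f : ℝ → ℝ := fun τ => (-2) * gaussTail ((a + τ) / (2 * √(t - τ))) with hf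
  have hd : ∀ τ, τ < t → HasDerivAt f
      (2 * gauss (a + τ) (t - τ) + hitDensity (a + τ) (t - τ)) τ := by
    intro τ hτ
    have hu : 0 < t - τ := sub_pos.2 hτ
    have hA : HasDerivAt (fun τ => a + τ) 1 τ := (hasDerivAt_id τ).const_add a
    have hU : HasDerivAt (fun τ => t - τ) (-1) τ := (hasDerivAt_id τ).const_sub t
    have hs0 : √(t - τ) ≠ 0 := by positivity
    have hq := hA.div ((hU.sqrt hu.ne').const_mul 2) (by positivity)
    refine (((hasDerivAt_gaussTail _).comp τ hq).const_mul (-2)).congr_deriv ?_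
    have hpi := Real.pi_pos
    have hsq : √(t - τ) ^ 2 = t - τ := Real.sq_sqrt hu.le
    have e : -((a + τ) / (2 * √(t - τ))) ^ 2 = -(a + τ) ^ 2 / (4 * (t - τ)) := by
      rw [div_pow, mul_pow, hsq]
      ring
    simp only [Pi.div_apply]
    rw [e, hitDensity, gauss, show 4 * Real.pi * (t - τ) = 2 ^ 2 * (Real.pi * (t - τ)) by ring,
      Real.sqrt_mul (by positivity), Real.sqrt_sq (by norm_num), Real.sqrt_mul hpi.le]
    generalize Real.exp (-(a + τ) ^ 2 / (4 * (t - τ))) = X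
    generalize √(t - τ) = S at *
    rw [← hsq]
    field_simp
    ring
  have hl : Tendsto f (𝓝[>] 0) (𝓝 (f 0)) :=
    (hd 0 ht).continuousAt.tendsto.mono_left nhdsWithin_le_nhds
  have hr : Tendsto f (𝓝[<] t) (𝓝 0) := by
    have hN : Tendsto (fun τ => a + τ) (𝓝[<] t) (𝓝 (a + t)) :=
      (Continuous.tendsto (by fun_prop) t).mono_left nhdsWithin_le_nhds
    have hD : Tendsto (fun τ => 2 * √(t - τ)) (𝓝[<] t) (𝓝[>] 0) := by
      refine tendsto_nhdsWithin_iff.2 ⟨?_, ?_⟩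
      · have : Continuous fun τ => 2 * √(t - τ) := by fun_prop
        simpa using (this.tendsto t).mono_left nhdsWithin_le_nhds
      · filter_upwards [self_mem_nhdsWithin] with τ hτ
        have : 0 < t - τ := sub_pos.2 hτ
        exact Set.mem_Ioi.2 (by positivity)
    have h := hN.pos_mul_atTop (by positivity) (tendsto_inv_nhdsGT_zero.comp hD)
    simpa [hf, Function.comp_def, div_eq_mul_inv] using
      (tendsto_gaussTail_atTop.comp h).const_mul (-2)
  have := lintegral_Ioo_of_hasDerivAt ht (fun τ hτ => hd τ hτ.2) (fun τ hτ =>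
    add_nonneg (mul_nonneg zero_le_two (gauss_nonneg _ _))
      (hitDensity_nonneg (by linarith [hτ.1]) (sub_pos.2 hτ.2).le)) hl hr
  have hv : 0 - f 0 = 2 * gaussTail (a / (2 * √t)) := by
    simp [hf]
  rwa [hv] at this

/-- The process is conservative. -/
theorem sojourn_mass {a t : ℝ} (ha : 0 ≤ a) (ht : 0 < t) :
    (∫⁻ z in Set.Ioi (0 : ℝ), ∫⁻ _τ, 1 ∂sojourn a z t) + ∫⁻ _τ, 1 ∂sojourn a 0 t = 1 := by
  have hd0 : dirichlet a 0 t = 0 := by simp [dirichlet]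
  simp only [lintegral_sojourn _ _ _ (measurable_const (a := (1 : ℝ≥0∞))), mul_one, hd0,
    ENNReal.ofReal_zero, zero_add, add_zero]
  rw [lintegral_add_left (by fun_prop), lintegral_lintegral_swap (by fun_prop), add_assoc,
    ← lintegral_add_right _ (by fun_prop)]
  have h : ∫⁻ τ in Set.Ioo 0 t, ((∫⁻ z in Set.Ioi (0 : ℝ),
      ENNReal.ofReal (hitDensity (a + z + τ) (t - τ))) +
        ENNReal.ofReal (hitDensity (a + τ) (t - τ))) = ∫⁻ τ in Set.Ioo 0 t,
      ENNReal.ofReal (2 * gauss (a + τ) (t - τ) + hitDensity (a + τ) (t - τ)) := by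
    refine setLIntegral_congr_fun measurableSet_Ioo fun τ hτ => ?_
    have hu : 0 < t - τ := sub_pos.2 hτ.2
    have h0 : 0 ≤ a + τ := add_nonneg ha hτ.1.le
    rw [ENNReal.ofReal_add (mul_nonneg zero_le_two (gauss_nonneg _ _))
      (hitDensity_nonneg h0 hu.le), ← lintegral_hitDensity h0 hu]
    simp only [add_right_comm]
  rw [h, (lintegral_dirichlet ha ht).2, (lintegral_gauss_add_hitDensity ha ht).2,
    ← ENNReal.ofReal_add (lintegral_dirichlet ha ht).1 (lintegral_gauss_add_hitDensity ha ht).1]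
  simp

theorem gaussKernel_nonneg {d : ℕ} (ξ : EuclideanSpace ℝ (Fin d)) {u : ℝ} (hu : 0 ≤ u) :
    0 ≤ gaussKernel ξ u := by
  have := Real.pi_pos
  unfold gaussKernel
  exact mul_nonneg (Real.rpow_nonneg (by positivity) _) (Real.exp_pos _).le

@[fun_prop]
theorem measurable_gaussKernel_comp {α : Type*} [MeasurableSpace α] {d : ℕ}
    {f : α → EuclideanSpace ℝ (Fin d)} {g : α → ℝ} (hf : Measurable f) (hg : Measurable g) :
    Measurable fun x => gaussKernel (f x) (g x) := by
  unfold gaussKernel; fun_prop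

theorem lintegral_exp_neg_mul_sq {d : ℕ} {b : ℝ} (hb : 0 < b) :
    ∫⁻ ζ : EuclideanSpace ℝ (Fin d), ENNReal.ofReal (Real.exp (-b * ‖ζ‖ ^ 2)) =
      ENNReal.ofReal ((Real.pi / b) ^ ((d : ℝ) / 2)) := by
  have h := GaussianFourier.integral_rexp_neg_mul_sq_norm (V := EuclideanSpace ℝ (Fin d)) hb
  rw [finrank_euclideanSpace_fin] at h
  have hpos : 0 < (Real.pi / b) ^ ((d : ℝ) / 2) := Real.rpow_pos_of_pos (by positivity) _
  rw [← h, ofReal_integral_eq_lintegral_ofReal]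
  · by_contra hn
    rw [integral_undef hn] at h
    exact hpos.ne h
  · exact Eventually.of_forall fun ζ => (Real.exp_pos _).le

theorem lintegral_gaussKernel {d : ℕ} (ξ : EuclideanSpace ℝ (Fin d)) {u : ℝ} (hu : 0 < u) :
    ∫⁻ ζ : EuclideanSpace ℝ (Fin d), ENNReal.ofReal (gaussKernel (ξ - ζ) u) = 1 := by
  have hpi := Real.pi_pos
  rw [lintegral_sub_left_eq_self (fun ζ => ENNReal.ofReal (gaussKernel ζ u)) ξ]
  have e : ∀ ζ : EuclideanSpace ℝ (Fin d), ENNReal.ofReal (gaussKernel ζ u) =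
      ENNReal.ofReal ((4 * Real.pi * u) ^ (-(d : ℝ) / 2)) *
        ENNReal.ofReal (Real.exp (-(1 / (4 * u)) * ‖ζ‖ ^ 2)) := fun ζ => by
    rw [← ENNReal.ofReal_mul (Real.rpow_nonneg (by positivity) _), gaussKernel]
    ring_nf
  simp only [e]
  rw [lintegral_const_mul _ (by fun_prop), lintegral_exp_neg_mul_sq (by positivity),
    ← ENNReal.ofReal_mul (Real.rpow_nonneg (by positivity) _), neg_div,
    show Real.pi / (1 / (4 * u)) = 4 * Real.pi * u by field_simp,
    ← Real.rpow_add (by positivity), neg_add_cancel, Real.rpow_zero, ENNReal.ofReal_one]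

/-- The semigroup property of the Gauss kernel on `ℝ^d`. -/
theorem lintegral_gaussKernel_mul {d : ℕ} (ξ η : EuclideanSpace ℝ (Fin d)) {u v : ℝ}
    (hu : 0 < u) (hv : 0 < v) :
    ∫⁻ ζ : EuclideanSpace ℝ (Fin d), ENNReal.ofReal (gaussKernel (ξ - ζ) u) *
      ENNReal.ofReal (gaussKernel (ζ - η) v) = ENNReal.ofReal (gaussKernel (ξ - η) (u + v)) := by
  have hpi := Real.pi_pos
  have hw : 0 < u + v := by positivity
  -- The product is a Gaussian in `ζ` centred at the weighted mean `m` of `ξ` and `η`.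
  set m : EuclideanSpace ℝ (Fin d) := (v / (u + v)) • ξ + (u / (u + v)) • η with hm
  rw [← lintegral_add_right_eq_self _ m]
  have hsplit : v / (u + v) + u / (u + v) = 1 := by field_simp; ring
  have h1 : ∀ ζ, ξ - (ζ + m) = (u / (u + v)) • (ξ - η) - ζ := fun ζ => by
    have : ξ = (v / (u + v) + u / (u + v)) • ξ := by rw [hsplit, one_smul]
    nth_rewrite 1 [this]
    rw [hm]; module
  have h2 : ∀ ζ, ζ + m - η = ζ + (v / (u + v)) • (ξ - η) := fun ζ => by
    have : η = (v / (u + v) + u / (u + v)) • η := by rw [hsplit, one_smul]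
    nth_rewrite 1 [this]
    rw [hm]; module
  have e : ∀ ζ, ENNReal.ofReal (gaussKernel (ξ - (ζ + m)) u) *
      ENNReal.ofReal (gaussKernel (ζ + m - η) v) =
      ENNReal.ofReal ((4 * Real.pi * u) ^ (-(d : ℝ) / 2) * (4 * Real.pi * v) ^ (-(d : ℝ) / 2) *
        Real.exp (-‖ξ - η‖ ^ 2 / (4 * (u + v)))) *
        ENNReal.ofReal (Real.exp (-((u + v) / (4 * u * v)) * ‖ζ‖ ^ 2)) := by
    intro ζ
    rw [← ENNReal.ofReal_mul (gaussKernel_nonneg _ hu.le), h1, h2, ← ENNReal.ofReal_mul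
      (mul_nonneg (mul_nonneg (Real.rpow_nonneg (by positivity) _)
        (Real.rpow_nonneg (by positivity) _)) (Real.exp_pos _).le)]
    congr 1
    generalize ξ - η = p
    have hexp : Real.exp (-‖(u / (u + v)) • p - ζ‖ ^ 2 / (4 * u)) *
        Real.exp (-‖ζ + (v / (u + v)) • p‖ ^ 2 / (4 * v)) =
        Real.exp (-‖p‖ ^ 2 / (4 * (u + v))) *
          Real.exp (-((u + v) / (4 * u * v)) * ‖ζ‖ ^ 2) := by
      rw [← Real.exp_add, ← Real.exp_add]
      congr 1
      rw [norm_sub_sq_real, norm_add_sq_real, norm_smul, norm_smul, inner_smul_left,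
        inner_smul_right, real_inner_comm ζ p, Real.norm_of_nonneg (by positivity),
        Real.norm_of_nonneg (by positivity)]
      simp only [conj_trivial]
      field_simp
      ring
    unfold gaussKernel
    rw [mul_mul_mul_comm, hexp]
    ring
  simp only [e]
  rw [lintegral_const_mul _ (by fun_prop), lintegral_exp_neg_mul_sq (by positivity),
    ← ENNReal.ofReal_mul (mul_nonneg (mul_nonneg (Real.rpow_nonneg (by positivity) _)
        (Real.rpow_nonneg (by positivity) _)) (Real.exp_pos _).le), gaussKernel]
  congr 1
  have hpow : (4 * Real.pi * u) ^ (-(d : ℝ) / 2) * (4 * Real.pi * v) ^ (-(d : ℝ) / 2) *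
      (Real.pi / ((u + v) / (4 * u * v))) ^ ((d : ℝ) / 2) =
      (4 * Real.pi * (u + v)) ^ (-(d : ℝ) / 2) := by
    have hb : 4 * Real.pi * u * (4 * Real.pi * v) =
        4 * Real.pi * (u + v) * (Real.pi / ((u + v) / (4 * u * v))) := by
      field_simp
    have hc : 0 < Real.pi / ((u + v) / (4 * u * v)) := by positivity
    rw [← Real.mul_rpow (by positivity) (by positivity), hb,
      Real.mul_rpow (by positivity) hc.le, mul_assoc, neg_div, ← Real.rpow_add hc,
      neg_add_cancel, Real.rpow_zero, mul_one]
  rw [← hpow]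
  ring

/-! ### Disintegration of the fundamental solution -/

/-- The fundamental solution as a mixture of tangential Gauss kernels: the tangential component only
moves during the time `t - τ` that is spent in the interior. Here `ξ` is the tangential
displacement, and `a`, `c` are the normal coordinates of the two points. -/
def profile {d : ℕ} (ξ : EuclideanSpace ℝ (Fin d)) (a c t : ℝ) : ℝ≥0∞ :=
  ∫⁻ τ, ENNReal.ofReal (gaussKernel ξ (t - τ)) ∂sojourn a c t

theorem lintegral_profile_mul_profile {d : ℕ} (ξ η : EuclideanSpace ℝ (Fin d)) (a z c : ℝ)
    {t s : ℝ} (ht : 0 < t) (hs : 0 < s) :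
    ∫⁻ ζ, profile (ξ - ζ) a z t * profile (ζ - η) z c s =
      ∫⁻ τ, ∫⁻ σ, ENNReal.ofReal (gaussKernel (ξ - η) (t + s - (τ + σ)))
        ∂sojourn z c s ∂sojourn a z t := by
  have h : ∀ ζ, profile (ξ - ζ) a z t * profile (ζ - η) z c s =
      ∫⁻ τ, ∫⁻ σ, ENNReal.ofReal (gaussKernel (ξ - ζ) (t - τ)) *
        ENNReal.ofReal (gaussKernel (ζ - η) (s - σ)) ∂sojourn z c s ∂sojourn a z t := fun ζ =>
    (lintegral_lintegral_mul (Measurable.aemeasurable (by fun_prop))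
      (Measurable.aemeasurable (by fun_prop))).symm
  simp only [h]
  have hm : Measurable fun p : EuclideanSpace ℝ (Fin d) × ℝ =>
      ∫⁻ σ, ENNReal.ofReal (gaussKernel (ξ - p.1) (t - p.2)) *
        ENNReal.ofReal (gaussKernel (p.1 - η) (s - σ)) ∂sojourn z c s :=
    Measurable.lintegral_prod_right' (f := fun q : (EuclideanSpace ℝ (Fin d) × ℝ) × ℝ =>
      ENNReal.ofReal (gaussKernel (ξ - q.1.1) (t - q.1.2)) *
        ENNReal.ofReal (gaussKernel (q.1.1 - η) (s - q.2))) (by fun_prop)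
  rw [lintegral_lintegral_swap hm.aemeasurable]
  refine lintegral_congr_ae ?_
  filter_upwards [ae_sojourn a z ht] with τ hτ
  rw [lintegral_lintegral_swap (Measurable.aemeasurable (by unfold Function.uncurry; fun_prop))]
  refine lintegral_congr_ae ?_
  filter_upwards [ae_sojourn z c hs] with σ hσ
  rw [lintegral_gaussKernel_mul ξ η (sub_pos.2 hτ.2) (sub_pos.2 hσ.2)]
  congr 2
  ring

theorem lintegral_profile {d : ℕ} (ξ : EuclideanSpace ℝ (Fin d)) (a z : ℝ) {t : ℝ}
    (ht : 0 < t) :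
    ∫⁻ ζ, profile (ξ - ζ) a z t = ∫⁻ _τ, 1 ∂sojourn a z t := by
  unfold profile
  rw [lintegral_lintegral_swap (Measurable.aemeasurable (by unfold Function.uncurry; fun_prop))]
  refine lintegral_congr_ae ?_
  filter_upwards [ae_sojourn a z ht] with τ hτ
  exact lintegral_gaussKernel ξ (sub_pos.2 hτ.2)

theorem profile_semigroup {d : ℕ} (ξ η : EuclideanSpace ℝ (Fin d)) {a c t s : ℝ} (ha : 0 ≤ a)
    (hc : 0 ≤ c) (ht : 0 < t) (hs : 0 < s) :
    (∫⁻ z in Set.Ioi (0 : ℝ), ∫⁻ ζ, profile (ξ - ζ) a z t * profile (ζ - η) z c s) +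
      ∫⁻ ζ, profile (ξ - ζ) a 0 t * profile (ζ - η) 0 c s = profile (ξ - η) a c (t + s) := by
  simp only [lintegral_profile_mul_profile ξ η _ _ _ ht hs]
  exact sojourn_semigroup ha hc ht hs
    (φ := fun ρ => ENNReal.ofReal (gaussKernel (ξ - η) (t + s - ρ))) (by fun_prop)

theorem profile_mass {d : ℕ} (ξ : EuclideanSpace ℝ (Fin d)) {a t : ℝ} (ha : 0 ≤ a)
    (ht : 0 < t) :
    (∫⁻ z in Set.Ioi (0 : ℝ), ∫⁻ ζ, profile (ξ - ζ) a z t) + ∫⁻ ζ, profile (ξ - ζ) a 0 t = 1 := by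
  simp only [lintegral_profile ξ _ _ ht]
  exact sojourn_mass ha ht

variable {n : ℕ}

/-- The tangential component `x'` of `x = (x', x_N)`. -/
def tangential (x : EuclideanSpace ℝ (Fin (n + 1))) : EuclideanSpace ℝ (Fin n) :=
  WithLp.toLp 2 fun i => x i.castSucc

/-- The point `(ζ, a)` with tangential component `ζ` and normal coordinate `a`. -/
def joinCoord (a : ℝ) (ζ : EuclideanSpace ℝ (Fin n)) : EuclideanSpace ℝ (Fin (n + 1)) :=
  WithLp.toLp 2 (Fin.snoc (α := fun _ => ℝ) ζ.ofLp a)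

@[simp] theorem joinCoord_last (a : ℝ) (ζ : EuclideanSpace ℝ (Fin n)) :
    joinCoord a ζ (Fin.last n) = a := by simp [joinCoord]

@[simp] theorem tangential_joinCoord (a : ℝ) (ζ : EuclideanSpace ℝ (Fin n)) :
    tangential (joinCoord a ζ) = ζ := by
  ext i; simp [tangential, joinCoord]

theorem measurePreserving_joinCoord :
    MeasurePreserving (fun p : ℝ × EuclideanSpace ℝ (Fin n) => joinCoord p.1 p.2) := by
  have h1 : MeasurePreserving (Prod.map id (WithLp.ofLp) :
      ℝ × EuclideanSpace ℝ (Fin n) → ℝ × (Fin n → ℝ)) :=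
    (MeasurePreserving.id _).prod (PiLp.volume_preserving_ofLp (Fin n))
  have h2 := (volume_preserving_piFinSuccAbove (fun _ : Fin (n + 1) => ℝ) (Fin.last n)).symm
  have h3 := PiLp.volume_preserving_toLp (Fin (n + 1))
  have h := (h3.comp h2).comp h1
  refine (congrArg (fun f => MeasurePreserving f volume volume) (funext fun p => ?_)).mp h
  simp [joinCoord, MeasurableEquiv.piFinSuccAbove, Fin.insertNthEquiv, Function.comp]

theorem lintegral_intMeasure {f : EuclideanSpace ℝ (Fin (n + 1)) → ℝ≥0∞} (hf : Measurable f) :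
    ∫⁻ x, f x ∂intMeasure n = ∫⁻ a in Set.Ioi (0 : ℝ), ∫⁻ ζ, f (joinCoord a ζ) := by
  have hms : MeasurableSet (halfSpace n) :=
    measurableSet_lt measurable_const (by fun_prop)
  have hj := measurePreserving_joinCoord (n := n)
  rw [intMeasure, ← lintegral_indicator hms, ← hj.lintegral_comp (hf.indicator hms),
    Measure.volume_eq_prod,
    lintegral_prod (fun p => (halfSpace n).indicator f (joinCoord p.1 p.2))
      ((hf.indicator hms).comp hj.measurable).aemeasurable, ← lintegral_indicator measurableSet_Ioi]
  refine lintegral_congr fun a => ?_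
  by_cases ha : a ∈ Set.Ioi (0 : ℝ)
  · rw [Set.indicator_of_mem ha]
    refine lintegral_congr fun ζ => Set.indicator_of_mem ?_ _
    simpa [halfSpace] using ha
  · rw [Set.indicator_of_notMem ha]
    refine lintegral_eq_zero_of_ae_eq_zero (Eventually.of_forall fun ζ =>
      Set.indicator_of_notMem ?_ _)
    simpa [halfSpace] using ha

theorem lintegral_bdryMeasure {f : EuclideanSpace ℝ (Fin (n + 1)) → ℝ≥0∞} (hf : Measurable f) :
    ∫⁻ x, f x ∂bdryMeasure n = ∫⁻ ζ, f (joinCoord 0 ζ) :=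
  lintegral_map hf measurable_bdryPoint

theorem gaussKernel_eq_mul (z : EuclideanSpace ℝ (Fin (n + 1))) {t : ℝ} (ht : 0 < t) :
    gaussKernel z t = gaussKernel (tangential z) t * gauss (z (Fin.last n)) t := by
  have hpi := Real.pi_pos
  have hn : ‖z‖ ^ 2 = ‖tangential z‖ ^ 2 + z (Fin.last n) ^ 2 := by
    rw [EuclideanSpace.norm_sq_eq, EuclideanSpace.norm_sq_eq, Fin.sum_univ_castSucc]
    simp [tangential]
  have hp : (4 * Real.pi * t) ^ (-((n + 1 : ℕ) : ℝ) / 2) =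
      (4 * Real.pi * t) ^ (-(n : ℝ) / 2) * (√(4 * Real.pi * t))⁻¹ := by
    rw [Real.sqrt_eq_rpow, ← Real.rpow_neg (by positivity), ← Real.rpow_add (by positivity)]
    congr 1
    push_cast
    ring
  rw [gaussKernel, hn, hp, gaussKernel, gauss, neg_add, add_div, Real.exp_add]
  ring

theorem tangential_sub (x y : EuclideanSpace ℝ (Fin (n + 1))) :
    tangential (x - y) = tangential x - tangential y := rfl

theorem tangential_sub_reflect_add (x y : EuclideanSpace ℝ (Fin (n + 1))) (τ : ℝ) :
    tangential (x - reflect y + τ • eN n) = tangential x - tangential y := by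
  ext i
  simp [tangential, reflect, eN]

theorem last_sub_reflect_add (x y : EuclideanSpace ℝ (Fin (n + 1))) (τ : ℝ) :
    (x - reflect y + τ • eN n) (Fin.last n) = x (Fin.last n) + y (Fin.last n) + τ := by
  simp [reflect, eN]
  ring

/-- The integrand of `kernelH`, see `kernelG_eq`: `ξ` is the tangential displacement, `b` the sum of
the normal coordinates and `τ`, and `u = t - τ`. -/
def hitKernel {d : ℕ} (ξ : EuclideanSpace ℝ (Fin d)) (b u : ℝ) : ℝ :=
  gaussKernel ξ u * hitDensity b u

theorem hitKernel_nonneg {d : ℕ} (ξ : EuclideanSpace ℝ (Fin d)) {b u : ℝ} (hb : 0 ≤ b)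
    (hu : 0 ≤ u) : 0 ≤ hitKernel ξ b u :=
  mul_nonneg (gaussKernel_nonneg ξ hu) (hitDensity_nonneg hb hu)

theorem kernelG_eq (x y : EuclideanSpace ℝ (Fin (n + 1))) {t : ℝ} (ht : 0 < t) :
    kernelG x y t = gaussKernel (tangential x - tangential y) t *
        dirichlet (x (Fin.last n)) (y (Fin.last n)) t +
      ∫ τ in Set.Ioo 0 t, hitKernel (tangential x - tangential y)
        (x (Fin.last n) + y (Fin.last n) + τ) (t - τ) := by
  have h1 := gaussKernel_eq_mul (x - y) ht
  have h2 := gaussKernel_eq_mul (x - reflect y + (0 : ℝ) • eN n) ht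
  rw [tangential_sub_reflect_add, last_sub_reflect_add, zero_smul, add_zero, add_zero] at h2
  have h3 : kernelH x y t = ∫ τ in Set.Ioo 0 t, hitKernel (tangential x - tangential y)
        (x (Fin.last n) + y (Fin.last n) + τ) (t - τ) := by
    rw [kernelH, intervalIntegral.integral_of_le ht.le, integral_Ioc_eq_integral_Ioo,
      ← integral_const_mul]
    refine setIntegral_congr_fun measurableSet_Ioo fun τ hτ => ?_
    simp only
    rw [dGaussKernel_eq, gaussKernel_eq_mul _ (sub_pos.2 hτ.2), tangential_sub_reflect_add,
      last_sub_reflect_add, hitKernel, hitDensity]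
    have := (sub_pos.2 hτ.2).ne'
    field_simp
  rw [kernelG, h1, h2, h3, tangential_sub, dirichlet]
  simp only [PiLp.sub_apply]
  ring

/-- Along the domain of integration in `kernelH` the integrand stays bounded, uniformly for `t ≥ s`
and in the spatial variables: for small `u` the bound `b ≥ t - u` keeps `b` away from zero, so
that `exp(-b² / (4u))` beats every power of `1 / u`. -/
theorem hitKernel_le {d : ℕ} (ξ : EuclideanSpace ℝ (Fin d)) {b u t s : ℝ} (hs : 0 < s)
    (hst : s ≤ t) (hu : 0 < u) (hut : u ≤ t) (hb : t - u ≤ b) :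
    hitKernel ξ b u ≤ (1 + 2 / s + 16 / s ^ 2) ^ (d + 2) * (d + 3 : ℝ) ^ (d + 3) := by
  have hpi := Real.pi_gt_three
  have hb0 : 0 ≤ b := by linarith
  set c := 1 + 2 / s + 16 / s ^ 2 with hc
  set r := 1 + 1 / u with hr
  set p := b ^ 2 / (4 * u) with hp
  have hc1 : 0 ≤ c := by positivity
  have hp0 : 0 ≤ p := by positivity
  -- All factors are estimated by powers of `r` and `1 + p`, and `r` itself by `1 + p`.
  have hr1 : 1 ≤ r := by
    have : 0 < 1 / u := by positivity
    linarith
  have hinv : 1 / (4 * Real.pi * u) ≤ 1 / u :=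
    one_div_le_one_div_of_le hu (by nlinarith)
  have hinv0 : 0 ≤ 1 / (4 * Real.pi * u) := by positivity
  have k1 : gaussKernel ξ u ≤ r ^ d := by
    have e1 : (4 * Real.pi * u) ^ (-(d : ℝ) / 2) = (1 / (4 * Real.pi * u)) ^ ((d : ℝ) / 2) := by
      rw [one_div, Real.inv_rpow (by positivity), neg_div, Real.rpow_neg (by positivity)]
    have e2 : Real.exp (-‖ξ‖ ^ 2 / (4 * u)) ≤ 1 := by
      rw [Real.exp_le_one_iff, neg_div]
      have : 0 ≤ ‖ξ‖ ^ 2 / (4 * u) := by positivity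
      linarith
    calc gaussKernel ξ u ≤ (1 / (4 * Real.pi * u)) ^ ((d : ℝ) / 2) * 1 := by
          rw [gaussKernel, e1]
          gcongr
      _ ≤ r ^ ((d : ℝ) / 2) * 1 := by
          gcongr
          linarith
      _ ≤ r ^ (d : ℝ) * 1 := by
          gcongr
          linarith [(Nat.cast_nonneg d : (0 : ℝ) ≤ d)]
      _ = r ^ d := by rw [mul_one, Real.rpow_natCast]
  have k2 : gauss b u ≤ r * Real.exp (-p) := by
    have e1 : 1 / √(4 * Real.pi * u) ≤ r := by
      have hq : 1 / √(4 * Real.pi * u) = √(1 / (4 * Real.pi * u)) := by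
        rw [Real.sqrt_div' _ (by positivity), Real.sqrt_one]
      rw [hq, Real.sqrt_le_left (by linarith)]
      nlinarith
    rw [gauss, neg_div, div_eq_mul_one_div, mul_comm]
    gcongr
  have k3 : b / u ≤ (1 + p) * r := by
    have : (1 + p) * r - b / u = 1 + p + p / u + (b / 2 - 1) ^ 2 / u - p := by
      simp only [hp, hr]; field_simp; ring
    have h5 : 0 ≤ (b / 2 - 1) ^ 2 / u := by positivity
    have h6 : 0 ≤ p / u := by positivity
    linarith
  have k4 : r ≤ c * (1 + p) := by
    have h2s : 0 < 2 / s := by positivity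
    have h16 : 0 < 16 / s ^ 2 := by positivity
    have : 1 / u ≤ 2 / s + 16 / s ^ 2 * p := by
      rcases le_total (s / 2) u with h | h
      · have : 1 / u ≤ 2 / s := by
          rw [div_le_div_iff₀ hu hs]; linarith
        have := mul_nonneg h16.le hp0
        linarith
      · have hbs : s / 2 ≤ b := by linarith
        have : 1 / u ≤ 16 / s ^ 2 * p := by
          rw [hp, div_mul_div_comm, div_le_div_iff₀ hu (by positivity)]
          nlinarith [mul_nonneg hu.le (sub_nonneg.2 (pow_le_pow_left₀ (by positivity) hbs 2))]
        linarith
    nlinarith [mul_nonneg h2s.le hp0]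
  have k5 : (1 + p) ^ (d + 3) * Real.exp (-p) ≤ (d + 3 : ℝ) ^ (d + 3) := by
    have hM : (0 : ℝ) < d + 3 := by positivity
    have e1 : 1 + p ≤ (d + 3 : ℝ) * Real.exp (p / (d + 3)) := by
      have := Real.add_one_le_exp (p / (d + 3))
      calc 1 + p ≤ (d + 3 : ℝ) * (p / (d + 3) + 1) := by
            rw [mul_add, mul_div_cancel₀ _ hM.ne']
            linarith [(Nat.cast_nonneg d : (0 : ℝ) ≤ d)]
        _ ≤ _ := by gcongr
    have e2 : Real.exp (p / (d + 3)) ^ (d + 3) = Real.exp p := by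
      rw [← Real.exp_nat_mul]
      congr 1
      push_cast
      field_simp
    calc (1 + p) ^ (d + 3) * Real.exp (-p)
        ≤ ((d + 3 : ℝ) * Real.exp (p / (d + 3))) ^ (d + 3) * Real.exp (-p) := by gcongr
      _ = (d + 3 : ℝ) ^ (d + 3) := by
          rw [mul_pow, e2, mul_assoc, ← Real.exp_add, add_neg_cancel, Real.exp_zero, mul_one]
  have hr0 : 0 ≤ r := by linarith
  calc hitKernel ξ b u ≤ r ^ d * (((1 + p) * r) * (r * Real.exp (-p))) := by
        rw [hitKernel, hitDensity]
        have := gauss_nonneg b u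
        gcongr
    _ = r ^ (d + 2) * ((1 + p) * Real.exp (-p)) := by ring
    _ ≤ (c * (1 + p)) ^ (d + 2) * ((1 + p) * Real.exp (-p)) := by gcongr
    _ = c ^ (d + 2) * ((1 + p) ^ (d + 3) * Real.exp (-p)) := by rw [mul_pow]; ring
    _ ≤ _ := by gcongr

theorem integrableOn_hitKernel {d : ℕ} (ξ : EuclideanSpace ℝ (Fin d)) {a t : ℝ} (ha : 0 ≤ a)
    (ht : 0 < t) : IntegrableOn (fun τ => hitKernel ξ (a + τ) (t - τ)) (Set.Ioo 0 t) := by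
  have hm : Measurable fun τ => hitKernel ξ (a + τ) (t - τ) := by unfold hitKernel; fun_prop
  refine Measure.integrableOn_of_bounded
    (M := (1 + 2 / t + 16 / t ^ 2) ^ (d + 2) * (d + 3 : ℝ) ^ (d + 3)) (by simp)
    hm.aestronglyMeasurable ?_
  filter_upwards [ae_restrict_mem measurableSet_Ioo] with τ hτ
  have hu := sub_pos.2 hτ.2
  rw [Real.norm_of_nonneg (hitKernel_nonneg ξ (by linarith [hτ.1]) hu.le)]
  exact hitKernel_le ξ ht le_rfl hu (by linarith [hτ.1]) (by linarith)

theorem ofReal_kernelG {x y : EuclideanSpace ℝ (Fin (n + 1))} {t : ℝ}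
    (hx : 0 ≤ x (Fin.last n)) (hy : 0 ≤ y (Fin.last n)) (ht : 0 < t) :
    ENNReal.ofReal (kernelG x y t) =
      profile (tangential x - tangential y) (x (Fin.last n)) (y (Fin.last n)) t := by
  have hnn : ∀ τ ∈ Set.Ioo 0 t, 0 ≤ hitKernel (tangential x - tangential y)
        (x (Fin.last n) + y (Fin.last n) + τ) (t - τ) := fun τ hτ =>
    hitKernel_nonneg _ (by linarith [hτ.1]) (sub_pos.2 hτ.2).le
  have hd := dirichlet_nonneg hx hy ht.le
  rw [kernelG_eq x y ht, ENNReal.ofReal_add (mul_nonneg (gaussKernel_nonneg _ ht.le) hd)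
      (setIntegral_nonneg measurableSet_Ioo hnn), profile,
    lintegral_sojourn _ _ _ (by fun_prop), sub_zero, mul_comm (gaussKernel _ _),
    ENNReal.ofReal_mul hd, ofReal_integral_eq_lintegral_ofReal
      (integrableOn_hitKernel _ (add_nonneg hx hy) ht)
      ((ae_restrict_iff' measurableSet_Ioo).2 (Eventually.of_forall hnn))]
  congr 1
  refine setLIntegral_congr_fun measurableSet_Ioo fun τ hτ => ?_
  simp only
  rw [hitKernel, mul_comm, ENNReal.ofReal_mul (hitDensity_nonneg (by linarith [hτ.1])
    (sub_pos.2 hτ.2).le)]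

/-! ### Composition and bounds of the fundamental solution on the half-space -/

/-- The measure `dx + σ` on the closed half-space. -/
def closedMeasure (n : ℕ) : Measure (EuclideanSpace ℝ (Fin (n + 1))) :=
  intMeasure n + bdryMeasure n

instance : SFinite (bdryMeasure n) := by unfold bdryMeasure; infer_instance

instance : SFinite (intMeasure n) := by unfold intMeasure; infer_instance

instance : SFinite (closedMeasure n) := by unfold closedMeasure; infer_instance

theorem measurableSet_halfSpace : MeasurableSet (halfSpace n) :=
  measurableSet_lt measurable_const (by fun_prop)

theorem ae_mem_halfSpace : ∀ᵐ z ∂intMeasure n, z ∈ halfSpace n :=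
  ae_restrict_mem measurableSet_halfSpace

theorem ae_bdryMeasure_last : ∀ᵐ z ∂bdryMeasure n, z (Fin.last n) = 0 := by
  rw [bdryMeasure, ae_map_iff measurable_bdryPoint.aemeasurable
    (measurableSet_eq_fun (by fun_prop) measurable_const)]
  exact Eventually.of_forall fun ζ => joinCoord_last 0 ζ

theorem ae_closedMeasure_last : ∀ᵐ z ∂closedMeasure n, 0 ≤ z (Fin.last n) := by
  refine ae_add_measure_iff.2 ⟨?_, ?_⟩
  · filter_upwards [ae_mem_halfSpace] with z hz using le_of_lt hz
  · filter_upwards [ae_bdryMeasure_last] with z hz using hz.ge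

theorem kernelG_nonneg_of_last {x y : EuclideanSpace ℝ (Fin (n + 1))} {t : ℝ}
    (hx : 0 ≤ x (Fin.last n)) (hy : 0 ≤ y (Fin.last n)) (ht : 0 < t) : 0 ≤ kernelG x y t := by
  rw [kernelG_eq x y ht]
  exact add_nonneg (mul_nonneg (gaussKernel_nonneg _ ht.le) (dirichlet_nonneg hx hy ht.le))
    (setIntegral_nonneg measurableSet_Ioo fun τ hτ =>
      hitKernel_nonneg _ (by linarith [hτ.1]) (sub_pos.2 hτ.2).le)

theorem measurable_tangential :
    Measurable (tangential : EuclideanSpace ℝ (Fin (n + 1)) → EuclideanSpace ℝ (Fin n)) := by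
  unfold tangential
  fun_prop

theorem measurable_kernelG {t : ℝ} (ht : 0 < t) :
    Measurable fun p : EuclideanSpace ℝ (Fin (n + 1)) × EuclideanSpace ℝ (Fin (n + 1)) =>
      kernelG p.1 p.2 t := by
  have htan := measurable_tangential (n := n)
  simp only [kernelG_eq _ _ ht]
  refine Measurable.add (by fun_prop) ?_
  refine StronglyMeasurable.measurable ?_
  refine StronglyMeasurable.integral_prod_right' (f := fun q :
    (EuclideanSpace ℝ (Fin (n + 1)) × EuclideanSpace ℝ (Fin (n + 1))) × ℝ =>
      hitKernel (tangential q.1.1 - tangential q.1.2)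
        (q.1.1 (Fin.last n) + q.1.2 (Fin.last n) + q.2) (t - q.2)) ?_
  refine Measurable.stronglyMeasurable ?_
  unfold hitKernel
  fun_prop

theorem measurable_kernelG_right (x : EuclideanSpace ℝ (Fin (n + 1))) {t : ℝ} (ht : 0 < t) :
    Measurable fun y => kernelG x y t := by
  have h := measurable_kernelG (n := n) ht
  fun_prop

theorem measurable_kernelG_left (y : EuclideanSpace ℝ (Fin (n + 1))) {t : ℝ} (ht : 0 < t) :
    Measurable fun x => kernelG x y t := by
  have h := measurable_kernelG (n := n) ht
  fun_prop

theorem lintegral_closedMeasure {f : EuclideanSpace ℝ (Fin (n + 1)) → ℝ≥0∞}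
    (hf : Measurable f) : ∫⁻ x, f x ∂closedMeasure n =
      (∫⁻ a in Set.Ioi (0 : ℝ), ∫⁻ ζ, f (joinCoord a ζ)) + ∫⁻ ζ, f (joinCoord 0 ζ) := by
  rw [closedMeasure, lintegral_add_measure, lintegral_intMeasure hf, lintegral_bdryMeasure hf]

/-- The Chapman-Kolmogorov identity in `[0, ∞]`. -/
theorem lintegral_kernelG_mul_kernelG {x y : EuclideanSpace ℝ (Fin (n + 1))} {t s : ℝ}
    (hx : 0 ≤ x (Fin.last n)) (hy : 0 ≤ y (Fin.last n)) (ht : 0 < t) (hs : 0 < s) :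
    ∫⁻ z, ENNReal.ofReal (kernelG x z t) * ENNReal.ofReal (kernelG z y s) ∂closedMeasure n =
      ENNReal.ofReal (kernelG x y (t + s)) := by
  have h1 := measurable_kernelG_right x ht
  have h2 := measurable_kernelG_left y hs
  have key : ∀ a ζ, 0 ≤ a → ENNReal.ofReal (kernelG x (joinCoord a ζ) t) *
      ENNReal.ofReal (kernelG (joinCoord a ζ) y s) =
      profile (tangential x - ζ) (x (Fin.last n)) a t *
        profile (ζ - tangential y) a (y (Fin.last n)) s := fun a ζ ha => by
    rw [ofReal_kernelG hx (by simpa using ha) ht, ofReal_kernelG (by simpa using ha) hy hs]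
    simp
  rw [lintegral_closedMeasure (by fun_prop), ofReal_kernelG hx hy (by positivity),
    ← profile_semigroup (tangential x) (tangential y) hx hy ht hs]
  congr 1
  · exact setLIntegral_congr_fun measurableSet_Ioi fun a ha =>
      lintegral_congr fun ζ => key a ζ (le_of_lt ha)
  · exact lintegral_congr fun ζ => key 0 ζ le_rfl

theorem lintegral_kernelG {x : EuclideanSpace ℝ (Fin (n + 1))} {t : ℝ}
    (hx : 0 ≤ x (Fin.last n)) (ht : 0 < t) :
    ∫⁻ z, ENNReal.ofReal (kernelG x z t) ∂closedMeasure n = 1 := by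
  have h1 := measurable_kernelG_right x ht
  have key : ∀ a ζ, 0 ≤ a → ENNReal.ofReal (kernelG x (joinCoord a ζ) t) =
      profile (tangential x - ζ) (x (Fin.last n)) a t := fun a ζ ha => by
    rw [ofReal_kernelG hx (by simpa using ha) ht]
    simp
  rw [lintegral_closedMeasure (by fun_prop), ← profile_mass (tangential x) hx ht]
  congr 1
  · exact setLIntegral_congr_fun measurableSet_Ioi fun a ha =>
      lintegral_congr fun ζ => key a ζ (le_of_lt ha)
  · exact lintegral_congr fun ζ => key 0 ζ le_rfl

theorem integrable_kernelG {x : EuclideanSpace ℝ (Fin (n + 1))} {t : ℝ}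
    (hx : 0 ≤ x (Fin.last n)) (ht : 0 < t) :
    Integrable (fun z => kernelG x z t) (closedMeasure n) := by
  refine (lintegral_ofReal_ne_top_iff_integrable
    (measurable_kernelG_right x ht).aestronglyMeasurable ?_).1 ?_
  · filter_upwards [ae_closedMeasure_last] with z hz using kernelG_nonneg_of_last hx hz ht
  · rw [lintegral_kernelG hx ht]; simp

/-- The Chapman-Kolmogorov identity for the fundamental solution. -/
theorem integral_kernelG_mul_kernelG {x y : EuclideanSpace ℝ (Fin (n + 1))} {t s : ℝ}
    (hx : 0 ≤ x (Fin.last n)) (hy : 0 ≤ y (Fin.last n)) (ht : 0 < t) (hs : 0 < s) :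
    Integrable (fun z => kernelG x z t * kernelG z y s) (closedMeasure n) ∧
      ∫ z, kernelG x z t * kernelG z y s ∂closedMeasure n = kernelG x y (t + s) := by
  have hm : AEStronglyMeasurable (fun z => kernelG x z t * kernelG z y s) (closedMeasure n) :=
    ((measurable_kernelG_right x ht).mul (measurable_kernelG_left y hs)).aestronglyMeasurable
  have hnn : 0 ≤ᵐ[closedMeasure n] fun z => kernelG x z t * kernelG z y s := by
    filter_upwards [ae_closedMeasure_last] with z hz using
      mul_nonneg (kernelG_nonneg_of_last hx hz ht) (kernelG_nonneg_of_last hz hy hs)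
  have hl : ∫⁻ z, ENNReal.ofReal (kernelG x z t * kernelG z y s) ∂closedMeasure n =
      ENNReal.ofReal (kernelG x y (t + s)) := by
    rw [← lintegral_kernelG_mul_kernelG hx hy ht hs]
    refine lintegral_congr_ae ?_
    filter_upwards [ae_closedMeasure_last] with z hz using
      ENNReal.ofReal_mul (kernelG_nonneg_of_last hx hz ht)
  refine ⟨(lintegral_ofReal_ne_top_iff_integrable hm hnn).1 (by simp [hl]), ?_⟩
  rw [integral_eq_lintegral_of_nonneg_ae hnn hm, hl,
    ENNReal.toReal_ofReal (kernelG_nonneg_of_last hx hy (by positivity))]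

theorem exists_kernelG_le (x : EuclideanSpace ℝ (Fin (n + 1))) (hx : 0 ≤ x (Fin.last n)) {t : ℝ}
    (ht : 0 < t) : ∃ C, ∀ y : EuclideanSpace ℝ (Fin (n + 1)), 0 ≤ y (Fin.last n) →
      ‖kernelG x y t‖ ≤ C := by
  have hpi := Real.pi_pos
  refine ⟨(4 * Real.pi * t) ^ (-(n : ℝ) / 2) * (1 / √(4 * Real.pi * t)) +
    (1 + 2 / t + 16 / t ^ 2) ^ (n + 2) * (n + 3 : ℝ) ^ (n + 3) * t, fun y hy => ?_⟩
  rw [kernelG_eq x y ht]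
  refine (norm_add_le _ _).trans (add_le_add ?_ ?_)
  · have hexp : ∀ r : ℝ, 0 ≤ r → Real.exp (-r / (4 * t)) ≤ 1 := fun r hr => by
      rw [Real.exp_le_one_iff, neg_div, neg_nonpos]
      positivity
    have h1 : gaussKernel (tangential x - tangential y) t ≤
        (4 * Real.pi * t) ^ (-(n : ℝ) / 2) := by
      rw [gaussKernel]
      exact mul_le_of_le_one_right (Real.rpow_nonneg (by positivity) _) (hexp _ (by positivity))
    have h2 : dirichlet (x (Fin.last n)) (y (Fin.last n)) t ≤ 1 / √(4 * Real.pi * t) := by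
      refine (sub_le_self _ (gauss_nonneg _ _)).trans ?_
      rw [gauss]
      gcongr
      exact hexp _ (by positivity)
    have h3 := dirichlet_nonneg hx hy ht.le
    rw [Real.norm_of_nonneg (mul_nonneg (gaussKernel_nonneg _ ht.le) h3)]
    gcongr
  · have := norm_setIntegral_le_of_norm_le_const (μ := volume) (s := Set.Ioo 0 t)
      (f := fun τ => hitKernel (tangential x - tangential y)
        (x (Fin.last n) + y (Fin.last n) + τ) (t - τ))
      (C := (1 + 2 / t + 16 / t ^ 2) ^ (n + 2) * (n + 3 : ℝ) ^ (n + 3)) (by simp)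
      fun τ hτ => by
        have hu := sub_pos.2 hτ.2
        rw [Real.norm_of_nonneg (hitKernel_nonneg _ (by linarith [hτ.1]) hu.le)]
        exact hitKernel_le _ ht le_rfl hu (by linarith [hτ.1]) (by linarith)
    simpa [ht.le] using this

theorem continuousAt_kernelG {x y : EuclideanSpace ℝ (Fin (n + 1))} {s : ℝ}
    (hx : 0 ≤ x (Fin.last n)) (hy : 0 ≤ y (Fin.last n)) (hs : 0 < s) :
    ContinuousAt (fun t => kernelG x y t) s := by
  have hpi := Real.pi_pos
  set ξ := tangential x - tangential y with hξ
  set a := x (Fin.last n) + y (Fin.last n) with ha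
  have ha0 : 0 ≤ a := add_nonneg hx hy
  have hgK : ∀ u, 0 < u → ContinuousAt (fun u => gaussKernel ξ u) u := fun u hu => by
    have h1 : 4 * Real.pi * u ≠ 0 := by positivity
    have h2 : 4 * u ≠ 0 := by positivity
    unfold gaussKernel
    exact (ContinuousAt.rpow_const (by fun_prop) (Or.inl h1)).mul
      (ContinuousAt.rexp (ContinuousAt.div (by fun_prop) (by fun_prop) h2))
  have hg : ∀ b u, 0 < u → ContinuousAt (fun u => gauss b u) u := fun b u hu => by
    have h1 : √(4 * Real.pi * u) ≠ 0 := by positivity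
    have h2 : 4 * u ≠ 0 := by positivity
    unfold gauss
    exact ContinuousAt.div (ContinuousAt.rexp (ContinuousAt.div (by fun_prop) (by fun_prop) h2))
      (by fun_prop) h1
  have hh : ∀ b u, 0 < u → ContinuousAt (fun u => hitKernel ξ b u) u := fun b u hu => by
    unfold hitKernel hitDensity
    exact (hgK u hu).mul ((continuousAt_const.div continuousAt_id hu.ne').mul (hg b u hu))
  have hev : (fun t => kernelG x y t) =ᶠ[𝓝 s] fun t =>
      gaussKernel ξ t * dirichlet (x (Fin.last n)) (y (Fin.last n)) t +
        ∫ τ, (Set.Ioo 0 t).indicator (fun τ => hitKernel ξ (a + τ) (t - τ)) τ := by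
    filter_upwards [lt_mem_nhds hs] with t ht
    rw [kernelG_eq x y ht, integral_indicator measurableSet_Ioo]
  refine ContinuousAt.congr ?_ hev.symm
  refine ((hgK s hs).mul ((hg _ s hs).sub (hg _ s hs))).add ?_
  set C : ℝ := (1 + 2 / (s / 2) + 16 / (s / 2) ^ 2) ^ (n + 2) * (n + 3 : ℝ) ^ (n + 3) with hC
  have hC0 : 0 ≤ C := by positivity
  refine tendsto_integral_filter_of_dominated_convergence
    ((Set.Ioo 0 (2 * s)).indicator fun _ => C) ?_ ?_ ?_ ?_
  · refine Eventually.of_forall fun t => Measurable.aestronglyMeasurable ?_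
    refine Measurable.indicator ?_ measurableSet_Ioo
    unfold hitKernel
    fun_prop
  · filter_upwards [lt_mem_nhds (show s / 2 < s by linarith),
      gt_mem_nhds (show s < 2 * s by linarith)] with t h1 h2
    refine Eventually.of_forall fun τ => ?_
    by_cases hτ : τ ∈ Set.Ioo 0 t
    · have hu := sub_pos.2 hτ.2
      rw [Set.indicator_of_mem hτ, Set.indicator_of_mem (Set.mem_Ioo.2 ⟨hτ.1, hτ.2.trans h2⟩),
        Real.norm_of_nonneg (hitKernel_nonneg _ (by linarith [hτ.1]) hu.le)]
      exact hitKernel_le _ (by positivity) h1.le hu (by linarith [hτ.1]) (by linarith)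
    · rw [Set.indicator_of_notMem hτ, norm_zero]
      exact Set.indicator_nonneg (fun _ _ => hC0) _
  · exact (integrable_indicator_iff measurableSet_Ioo).2 (integrableOn_const measure_Ioo_lt_top.ne)
  · have hne : ∀ᵐ τ : ℝ, τ ≠ s := by simp [ae_iff]
    filter_upwards [hne] with τ hτ
    by_cases h0 : 0 < τ
    · rcases lt_or_gt_of_ne hτ with h | h
      · have hc : ContinuousAt (fun t => hitKernel ξ (a + τ) (t - τ)) s :=
          ContinuousAt.comp (f := fun t => t - τ) (hh (a + τ) (s - τ) (sub_pos.2 h))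
            (by fun_prop)
        rw [Set.indicator_of_mem (Set.mem_Ioo.2 ⟨h0, h⟩)]
        refine hc.tendsto.congr' ?_
        filter_upwards [lt_mem_nhds h] with t ht
        rw [Set.indicator_of_mem (Set.mem_Ioo.2 ⟨h0, ht⟩)]
      · rw [Set.indicator_of_notMem fun h' => absurd h'.2 (not_lt.2 h.le)]
        refine tendsto_const_nhds.congr' ?_
        filter_upwards [gt_mem_nhds h] with t ht
        rw [Set.indicator_of_notMem fun h' => absurd h'.2 (not_lt.2 ht.le)]
    · simp only [Set.indicator_of_notMem fun h' : τ ∈ Set.Ioo 0 _ => h0 h'.1]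
      exact tendsto_const_nhds

open Classical in
/-- The function on the closed half-space with values `φi` in the interior and `φb` on the boundary
(and `φb` on the rest of the space, where the value is irrelevant). -/
def combine {α : Type*} (φi φb : EuclideanSpace ℝ (Fin (n + 1)) → α) :
    EuclideanSpace ℝ (Fin (n + 1)) → α := (halfSpace n).piecewise φi φb

theorem combine_ae_int {α : Type*} (φi φb : EuclideanSpace ℝ (Fin (n + 1)) → α) :
    combine φi φb =ᵐ[intMeasure n] φi := by
  filter_upwards [ae_mem_halfSpace] with z hz
  classical exact Set.piecewise_eq_of_mem _ _ _ hz

theorem combine_ae_bdry {α : Type*} (φi φb : EuclideanSpace ℝ (Fin (n + 1)) → α) :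
    combine φi φb =ᵐ[bdryMeasure n] φb := by
  filter_upwards [ae_bdryMeasure_last] with z hz
  classical exact Set.piecewise_eq_of_notMem _ _ _ fun h => (ne_of_gt h) hz

theorem evolNonneg_eq (t : ℝ) (φi φb : EuclideanSpace ℝ (Fin (n + 1)) → ℝ≥0∞)
    (x : EuclideanSpace ℝ (Fin (n + 1))) :
    evolNonneg t φi φb x =
      ∫⁻ y, ENNReal.ofReal (kernelG x y t) * combine φi φb y ∂closedMeasure n := by
  rw [closedMeasure, lintegral_add_measure, evolNonneg]
  congr 1
  · refine lintegral_congr_ae ?_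
    filter_upwards [combine_ae_int φi φb] with y hy
    rw [hy]
  · refine lintegral_congr_ae ?_
    filter_upwards [combine_ae_bdry φi φb] with y hy
    rw [hy]

theorem evolDefined_iff (t : ℝ) (φi φb : EuclideanSpace ℝ (Fin (n + 1)) → ℝ)
    (x : EuclideanSpace ℝ (Fin (n + 1))) :
    EvolDefined t φi φb x ↔
      Integrable (fun y => kernelG x y t * combine φi φb y) (closedMeasure n) := by
  rw [closedMeasure, integrable_add_measure, EvolDefined]
  refine and_congr (integrable_congr ?_) (integrable_congr ?_)
  · filter_upwards [combine_ae_int φi φb] with y hy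
    rw [hy]
  · filter_upwards [combine_ae_bdry φi φb] with y hy
    rw [hy]

theorem evol_eq {t : ℝ} {φi φb : EuclideanSpace ℝ (Fin (n + 1)) → ℝ}
    {x : EuclideanSpace ℝ (Fin (n + 1))} (h : EvolDefined t φi φb x) :
    evol t φi φb x = ∫ y, kernelG x y t * combine φi φb y ∂closedMeasure n := by
  have h' := (evolDefined_iff t φi φb x).1 h
  rw [closedMeasure, integrable_add_measure] at h'
  rw [closedMeasure, integral_add_measure h'.1 h'.2, evol]
  congr 1
  · refine integral_congr_ae ?_
    filter_upwards [combine_ae_int φi φb] with y hy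
    rw [hy]
  · refine integral_congr_ae ?_
    filter_upwards [combine_ae_bdry φi φb] with y hy
    rw [hy]

theorem lintegral_kernelG_lintegral_kernelG {ψ : EuclideanSpace ℝ (Fin (n + 1)) → ℝ≥0∞}
    (hψ : AEMeasurable ψ (closedMeasure n)) {t s : ℝ} (ht : 0 < t) (hs : 0 < s)
    {x : EuclideanSpace ℝ (Fin (n + 1))} (hx : 0 ≤ x (Fin.last n)) :
    ∫⁻ z, ENNReal.ofReal (kernelG x z t) *
        ∫⁻ y, ENNReal.ofReal (kernelG z y s) * ψ y ∂closedMeasure n ∂closedMeasure n =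
      ∫⁻ y, ENNReal.ofReal (kernelG x y (t + s)) * ψ y ∂closedMeasure n := by
  have h1 := measurable_kernelG_right x ht
  have h2 := measurable_kernelG (n := n) hs
  simp only [← lintegral_const_mul' _ _ ENNReal.ofReal_ne_top]
  rw [lintegral_lintegral_swap]
  · refine lintegral_congr_ae ?_
    filter_upwards [ae_closedMeasure_last] with y hy
    have h3 := measurable_kernelG_left y hs
    simp only [← mul_assoc]
    rw [lintegral_mul_const _ (by fun_prop), lintegral_kernelG_mul_kernelG hx hy ht hs]
  · have h4 : AEMeasurable (fun p : EuclideanSpace ℝ (Fin (n + 1)) ×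
        EuclideanSpace ℝ (Fin (n + 1)) => ψ p.2) ((closedMeasure n).prod (closedMeasure n)) :=
      hψ.comp_snd
    have h5 : Measurable fun p : EuclideanSpace ℝ (Fin (n + 1)) ×
        EuclideanSpace ℝ (Fin (n + 1)) => ENNReal.ofReal (kernelG x p.1 t) := by fun_prop
    exact h5.aemeasurable.mul (h2.ennreal_ofReal.aemeasurable.mul h4)

/-- A bounded integrable function lies in every `L^p`, so its product with an `L^q` function is
integrable; directly, `|g φ| ≤ |g| + C |φ|^q`. -/
theorem integrable_mul_of_memLp {α : Type*} [MeasurableSpace α] {μ : Measure α} {g φ : α → ℝ}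
    {C : ℝ} (hg : Integrable g μ) (hC : ∀ᵐ y ∂μ, ‖g y‖ ≤ C) {q : ℝ≥0∞} (hq : 1 ≤ q)
    (hφ : MemLp φ q μ) : Integrable (fun y => g y * φ y) μ := by
  rcases eq_or_ne q ∞ with rfl | hqt
  · exact hg.mul_of_top_left hφ
  · have h1 : 1 ≤ q.toReal := by
      simpa using (ENNReal.toReal_le_toReal ENNReal.one_ne_top hqt).2 hq
    have hpow := hφ.integrable_norm_rpow (zero_lt_one.trans_le hq).ne' hqt
    refine (hg.norm.add (hpow.const_mul C)).mono'
      (hg.aestronglyMeasurable.mul hφ.aestronglyMeasurable) ?_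
    filter_upwards [hC] with y hy
    have h2 : ‖φ y‖ ≤ 1 + ‖φ y‖ ^ q.toReal := by
      rcases le_total ‖φ y‖ 1 with h | h
      · linarith [Real.rpow_nonneg (norm_nonneg (φ y)) q.toReal]
      · have := Real.rpow_le_rpow_of_exponent_le h h1
        rw [Real.rpow_one] at this
        linarith
    have h3 : 0 ≤ ‖φ y‖ ^ q.toReal := Real.rpow_nonneg (norm_nonneg _) _
    calc ‖g y * φ y‖ = ‖g y‖ * ‖φ y‖ := norm_mul _ _
      _ ≤ ‖g y‖ * (1 + ‖φ y‖ ^ q.toReal) := by gcongr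
      _ = ‖g y‖ + ‖g y‖ * ‖φ y‖ ^ q.toReal := by ring
      _ ≤ ‖g y‖ + C * ‖φ y‖ ^ q.toReal := by gcongr

theorem evolDefined_of_memLp {q : ℝ≥0∞} (hq : 1 ≤ q)
    {φi φb : EuclideanSpace ℝ (Fin (n + 1)) → ℝ} (hφi : MemLp φi q (intMeasure n))
    (hφb : MemLp φb q (bdryMeasure n)) {t : ℝ} (ht : 0 < t)
    {x : EuclideanSpace ℝ (Fin (n + 1))} (hx : 0 ≤ x (Fin.last n)) :
    EvolDefined t φi φb x := by
  obtain ⟨C, hC⟩ := exists_kernelG_le x hx ht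
  have hI := integrable_add_measure.1 (integrable_kernelG hx ht)
  have hae := ae_add_measure_iff.1 (ae_closedMeasure_last (n := n))
  exact ⟨integrable_mul_of_memLp hI.1 (hae.1.mono hC) hq hφi,
    integrable_mul_of_memLp hI.2 (hae.2.mono hC) hq hφb⟩

theorem evol_evol {q : ℝ≥0∞} (hq : 1 ≤ q)
    {φi φb : EuclideanSpace ℝ (Fin (n + 1)) → ℝ} (hφi : MemLp φi q (intMeasure n))
    (hφb : MemLp φb q (bdryMeasure n)) {t s : ℝ} (ht : 0 < t) (hs : 0 < s)
    {x : EuclideanSpace ℝ (Fin (n + 1))} (hx : 0 ≤ x (Fin.last n)) :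
    EvolDefined t (evol s φi φb) (evol s φi φb) x ∧
      evol t (evol s φi φb) (evol s φi φb) x = evol (t + s) φi φb x := by
  have hts : 0 < t + s := by positivity
  set ψ := combine φi φb with hψ
  have hψm : AEStronglyMeasurable ψ (closedMeasure n) :=
    aestronglyMeasurable_add_measure_iff.2
      ⟨hφi.aestronglyMeasurable.congr (combine_ae_int φi φb).symm,
        hφb.aestronglyMeasurable.congr (combine_ae_bdry φi φb).symm⟩
  have hdef := fun r (hr : 0 < r) z (hz : 0 ≤ z (Fin.last n)) =>
    evolDefined_of_memLp (n := n) hq hφi hφb hr (x := z) hz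
  have hev : ∀ᵐ z ∂closedMeasure n, evol s φi φb z =
      ∫ y, kernelG z y s * ψ y ∂closedMeasure n := by
    filter_upwards [ae_closedMeasure_last] with z hz using evol_eq (hdef s hs z hz)
  have h1 := measurable_kernelG_right x ht
  have h2 := measurable_kernelG (n := n) hs
  -- Absolute convergence of the double integral follows from the nonnegative case for `‖ψ‖`.
  have hF : Integrable (Function.uncurry fun z y => kernelG x z t * (kernelG z y s * ψ y))
      ((closedMeasure n).prod (closedMeasure n)) := by
    have hm : AEStronglyMeasurable (Function.uncurry fun z y =>
        kernelG x z t * (kernelG z y s * ψ y)) ((closedMeasure n).prod (closedMeasure n)) :=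
      (h1.comp measurable_fst).aestronglyMeasurable.mul
        (h2.aestronglyMeasurable.mul hψm.comp_snd)
    refine ⟨hm, ?_⟩
    rw [HasFiniteIntegral, lintegral_prod _ hm.enorm]
    have hfin := ((evolDefined_iff (t + s) φi φb x).1 (hdef _ hts x hx)).hasFiniteIntegral
    rw [HasFiniteIntegral] at hfin
    refine lt_of_eq_of_lt ?_ hfin
    have hab : ∀ r, 0 < r → ∀ w y : EuclideanSpace ℝ (Fin (n + 1)), 0 ≤ w (Fin.last n) →
        0 ≤ y (Fin.last n) → ‖kernelG w y r‖ₑ = ENNReal.ofReal (kernelG w y r) :=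
      fun r hr w y hw hy => Real.enorm_of_nonneg (kernelG_nonneg_of_last hw hy hr)
    have e1 : ∫⁻ y, ‖kernelG x y (t + s) * combine φi φb y‖ₑ ∂closedMeasure n =
        ∫⁻ y, ENNReal.ofReal (kernelG x y (t + s)) * ‖ψ y‖ₑ ∂closedMeasure n := by
      refine lintegral_congr_ae ?_
      filter_upwards [ae_closedMeasure_last] with y hy
      rw [enorm_mul, hab _ hts x y hx hy]
    rw [e1, ← lintegral_kernelG_lintegral_kernelG hψm.enorm ht hs hx]
    refine lintegral_congr_ae ?_
    filter_upwards [ae_closedMeasure_last] with z hz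
    rw [← lintegral_const_mul' _ _ ENNReal.ofReal_ne_top]
    refine lintegral_congr_ae ?_
    filter_upwards [ae_closedMeasure_last] with y hy
    simp only [Function.uncurry]
    rw [enorm_mul, enorm_mul, hab t ht x z hx hz, hab s hs z y hz hy]
  have hcomb : combine (evol s φi φb) (evol s φi φb) = evol s φi φb := by
    simp [combine]
  have hinner : (fun z => ∫ y, kernelG x z t * (kernelG z y s * ψ y) ∂closedMeasure n)
      =ᵐ[closedMeasure n] fun z => kernelG x z t * evol s φi φb z := by
    filter_upwards [hev] with z hz
    rw [hz, integral_const_mul]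
  have hD : EvolDefined t (evol s φi φb) (evol s φi φb) x := by
    rw [evolDefined_iff, hcomb]
    exact hF.integral_prod_left.congr hinner
  refine ⟨hD, ?_⟩
  rw [evol_eq hD, hcomb, evol_eq (hdef _ hts x hx), ← integral_congr_ae hinner,
    integral_integral_swap hF]
  refine integral_congr_ae ?_
  filter_upwards [ae_closedMeasure_last] with y hy
  simp only [← mul_assoc]
  rw [integral_mul_const, (integral_kernelG_mul_kernelG hx hy ht hs).2]

end

end DynBdry

/-! ### The semigroup property -/

theorem corollary1p2 (n : ℕ) :
    -- the identity for `t > 0`, with absolutely convergent integrals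
    (∀ x ∈ closure (DynBdry.halfSpace n), ∀ y ∈ closure (DynBdry.halfSpace n),
      ∀ t : ℝ, 0 < t → ∀ s : ℝ, 0 < s →
        Integrable (fun z => DynBdry.kernelG x z t * DynBdry.kernelG z y s)
          (DynBdry.intMeasure n) ∧
        Integrable (fun z => DynBdry.kernelG x z t * DynBdry.kernelG z y s)
          (DynBdry.bdryMeasure n) ∧
        DynBdry.kernelG x y (t + s) =
          (∫ z, DynBdry.kernelG x z t * DynBdry.kernelG z y s ∂(DynBdry.intMeasure n)) +
            ∫ z, DynBdry.kernelG x z t * DynBdry.kernelG z y s ∂(DynBdry.bdryMeasure n)) ∧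
    -- the identity for `t = 0`, where the right-hand side is the limit as `t → 0+`
    (∀ x ∈ closure (DynBdry.halfSpace n), ∀ y ∈ closure (DynBdry.halfSpace n),
      ∀ s : ℝ, 0 < s →
        Tendsto (fun t : ℝ =>
          (∫ z, DynBdry.kernelG x z t * DynBdry.kernelG z y s ∂(DynBdry.intMeasure n)) +
            ∫ z, DynBdry.kernelG x z t * DynBdry.kernelG z y s ∂(DynBdry.bdryMeasure n))
          (𝓝[>] 0) (𝓝 (DynBdry.kernelG x y s))) ∧
    -- the semigroup property for nonnegative measurable data
    (∀ φi φb : EuclideanSpace ℝ (Fin (n + 1)) → ℝ≥0∞,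
      AEMeasurable φi (DynBdry.intMeasure n) → AEMeasurable φb (DynBdry.bdryMeasure n) →
      ∀ t : ℝ, 0 < t → ∀ s : ℝ, 0 < s → ∀ x ∈ closure (DynBdry.halfSpace n),
        DynBdry.evolNonneg t (DynBdry.evolNonneg s φi φb) (DynBdry.evolNonneg s φi φb) x =
          DynBdry.evolNonneg (t + s) φi φb x) ∧
    -- the semigroup property for data in `L^q(Ω) × L^q(∂Ω)`
    (∀ q : ℝ≥0∞, 1 ≤ q → ∀ φi φb : EuclideanSpace ℝ (Fin (n + 1)) → ℝ,
      MemLp φi q (DynBdry.intMeasure n) → MemLp φb q (DynBdry.bdryMeasure n) →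
      ∀ t : ℝ, 0 < t → ∀ s : ℝ, 0 < s → ∀ x ∈ closure (DynBdry.halfSpace n),
        DynBdry.EvolDefined s φi φb x ∧
        DynBdry.EvolDefined t (DynBdry.evol s φi φb) (DynBdry.evol s φi φb) x ∧
        DynBdry.EvolDefined (t + s) φi φb x ∧
        DynBdry.evol t (DynBdry.evol s φi φb) (DynBdry.evol s φi φb) x =
          DynBdry.evol (t + s) φi φb x) := by
  have hcl : ∀ x ∈ closure (DynBdry.halfSpace n), 0 ≤ x (Fin.last n) :=
    fun x hx => DynBdry.closure_halfSpace_subset n hx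
  have hCK : ∀ x ∈ closure (DynBdry.halfSpace n), ∀ y ∈ closure (DynBdry.halfSpace n),
      ∀ t : ℝ, 0 < t → ∀ s : ℝ, 0 < s →
        Integrable (fun z => DynBdry.kernelG x z t * DynBdry.kernelG z y s)
          (DynBdry.intMeasure n) ∧
        Integrable (fun z => DynBdry.kernelG x z t * DynBdry.kernelG z y s)
          (DynBdry.bdryMeasure n) ∧
        DynBdry.kernelG x y (t + s) =
          (∫ z, DynBdry.kernelG x z t * DynBdry.kernelG z y s ∂(DynBdry.intMeasure n)) +
            ∫ z, DynBdry.kernelG x z t * DynBdry.kernelG z y s ∂(DynBdry.bdryMeasure n) := by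
    intro x hx y hy t ht s hs
    obtain ⟨h1, h2⟩ := DynBdry.integral_kernelG_mul_kernelG (hcl x hx) (hcl y hy) ht hs
    obtain ⟨h3, h4⟩ := integrable_add_measure.1 h1
    exact ⟨h3, h4, h2.symm.trans (integral_add_measure h3 h4)⟩
  refine ⟨hCK, ?_, ?_, ?_⟩
  · intro x hx y hy s hs
    have hc : Tendsto (fun t : ℝ => DynBdry.kernelG x y (t + s)) (𝓝[>] 0)
        (𝓝 (DynBdry.kernelG x y s)) := by
      have hadd : Tendsto (fun t : ℝ => t + s) (𝓝[>] 0) (𝓝 s) := by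
        have : Continuous fun t : ℝ => t + s := by fun_prop
        simpa using (this.tendsto 0).mono_left nhdsWithin_le_nhds
      exact (DynBdry.continuousAt_kernelG (hcl x hx) (hcl y hy) hs).tendsto.comp hadd
    refine hc.congr' ?_
    filter_upwards [self_mem_nhdsWithin] with t ht
    exact (hCK x hx y hy t ht s hs).2.2
  · intro φi φb hφi hφb t ht s hs x hx
    have hm : AEMeasurable (DynBdry.combine φi φb) (DynBdry.closedMeasure n) :=
      aemeasurable_add_measure_iff.2
        ⟨hφi.congr (DynBdry.combine_ae_int φi φb).symm,
          hφb.congr (DynBdry.combine_ae_bdry φi φb).symm⟩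
    rw [DynBdry.evolNonneg_eq (t + s),
      ← DynBdry.lintegral_kernelG_lintegral_kernelG hm ht hs (hcl x hx)]
    simp only [← DynBdry.evolNonneg_eq s φi φb]
    rw [DynBdry.closedMeasure, lintegral_add_measure]
    rfl
  · intro q hq φi φb hφi hφb t ht s hs x hx
    obtain ⟨h1, h2⟩ := DynBdry.evol_evol hq hφi hφb ht hs (hcl x hx)
    exact ⟨DynBdry.evolDefined_of_memLp hq hφi hφb hs (hcl x hx), h1,
      DynBdry.evolDefined_of_memLp hq hφi hφb (by positivity) (hcl x hx), h2⟩
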